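/- Fix $0<H<\frac12$, $0<T<\infty$ and $p\ge 1$, and write $\|f\|_\infty=\sup_{0\le t\le T}|f(t)|$. For $0<s<t$ put $$K_{H,1}(t,s)=c_H\,t^{H-\frac12}s^{\frac12-H}(t-s)^{H-\frac12},\qquad K_{H,2}(t,s)=c_H\left(\tfrac12-H\right)s^{\frac12-H}\int_s^t u^{H-\frac32}(u-s)^{H-\frac12}\,du,$$ where $c_H=\left(\frac{2H}{(1-2H)\,\beta(1-2H,\,H+\frac12)}\right)^{1/2}$ and $\beta$ is the Beta function, and for a path $f$ with $f(0)=0$ that is $\lambda'$-Hölder continuous on $[0,T]$ for some $\lambda'>\frac12-H$ put $$(\Lambda_Hf)(t)=\int_0^t[f(t)-f(s)]\,\partial_sK_{H,1}(t,s)\,ds-\int_0^t\partial_sK_{H,2}(t,s)f(s)\,ds,\qquad 0\le t\le T.$$ Let $B=(B(t))_{t\ge0}$ be a real standard Brownian motion and let $B_H$ be the fractional Brownian motion with Hurst exponent $H$ that it realizes, that is, $B_H=\Lambda_HB$ on $[0,T]$ almost surely. Let $(\epsilon_k)_{k\ge1}$ be a sequence of positive numbers with $\epsilon_k\downarrow0$.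 For each $k$ let $T^k_0=0$ and $$T^k_n=\inf\{t>T^k_{n-1}:\ |B(t)-B(T^k_{n-1})|=\epsilon_k\},\quad n\ge1,\qquad A^k(t)=\sum_{n\ge1}\big(B(T^k_n)-B(T^k_{n-1})\big)\mathbf 1_{\{T^k_n\le t\}},$$ let $\bar t_k=\max\{T^k_n: T^k_n\le t\}$ and $\bar t_k^{+}=\min\{T^k_n:\bar t_k<T^k_n\}\wedge T$, and define $$B^k_H(t)=\int_0^{\bar t_k}\partial_sK_{H,1}(\bar t_k,s)\big[A^k(\bar t_k)-A^k(\bar s_k^{+})\big]ds-\int_0^{\bar t_k}\partial_sK_{H,2}(\bar t_k,s)A^k(s)\,ds,\qquad 0\le t\le T.$$ Then for every pair $(\delta,\lambda)$ with $\max\{0,1-\frac{pH}2\}<\delta<1$ and $\frac{1-H}2<\lambda<\frac12+\frac{\delta-1}{p}$ there is a constant $C$, depending only on $p,\delta,H,T,\lambda$, such that $$\mathbb E\,\|B^k_H-B_H\|_\infty^p\le C\,\epsilon_k^{\,p(1-2\lambda)+2(\delta-1)}\qquad\text{for every }k\ge1.$$ -/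

import Mathlib

open MeasureTheory ProbabilityTheory Filter Topology
open scoped NNReal ENNReal

noncomputable section

namespace KnightFBM

/-- The normalizing constant `c_H = (2H / ((1 - 2H) β(1 - 2H, H + 1/2)))^{1/2}` of the Volterra
kernel of fractional Brownian motion, `0 < H < 1/2`, with `β(a, b) = Γ(a) Γ(b) / Γ(a + b)`. -/
def cH (H : ℝ) : ℝ :=
  Real.sqrt (2 * H /
    ((1 - 2 * H) * (Real.Gamma (1 - 2 * H) * Real.Gamma (H + 1 / 2) / Real.Gamma (3 / 2 - H))))

/-- The kernel `K_{H,1}(t,s)`, used for `0 < s < t`. -/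
def K₁ (H t s : ℝ) : ℝ :=
  cH H * t ^ (H - 1 / 2) * s ^ (1 / 2 - H) * (t - s) ^ (H - 1 / 2)

/-- The kernel `K_{H,2}(t,s)`, used for `0 < s < t`. -/
def K₂ (H t s : ℝ) : ℝ :=
  cH H * (1 / 2 - H) * s ^ (1 / 2 - H) *
    ∫ u in s..t, u ^ (H - 3 / 2) * (u - s) ^ (H - 1 / 2)

/-- `∂_s K_{H,1}(t,s)`. -/
def dK₁ (H t s : ℝ) : ℝ := deriv (fun r => K₁ H t r) s

/-- `∂_s K_{H,2}(t,s)`. -/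
def dK₂ (H t s : ℝ) : ℝ := deriv (fun r => K₂ H t r) s

/-- The operator `Λ_H` on paths:
`(Λ_H f)(t) = ∫_0^t [f(t) - f(s)] ∂_s K_{H,1}(t,s) ds - ∫_0^t ∂_s K_{H,2}(t,s) f(s) ds`. -/
def Lam (H : ℝ) (f : ℝ≥0 → ℝ) (t : ℝ≥0) : ℝ :=
  (∫ s in (0 : ℝ)..t, (f t - f s.toNNReal) * dK₁ H t s) -
    ∫ s in (0 : ℝ)..t, dK₂ H t s * f s.toNNReal

/-- The times `T_0 = 0`, `T_{n+1} = inf {t > T_n : |f t - f T_n| = ε}` of a path `f`, with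
`inf ∅ = ∞` (so every time after an infinite one is infinite). -/
def knightTime (f : ℝ≥0 → ℝ) (ε : ℝ) : ℕ → ℝ≥0∞
  | 0 => 0
  | n + 1 => ⨅ (t : ℝ≥0) (_ : knightTime f ε n < t ∧
      |f t - f (knightTime f ε n).toNNReal| = ε), (t : ℝ≥0∞)

open Classical in
/-- The embedded walk `A(t) = ∑_{n ≥ 1} (f(T_n) - f(T_{n-1})) 1_{T_n ≤ t}`. For a continuous path
and `ε > 0` the sum has only finitely many nonzero terms. -/
def knightWalk (f : ℝ≥0 → ℝ) (ε : ℝ) (t : ℝ≥0) : ℝ :=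
  ∑' n : ℕ, if knightTime f ε (n + 1) ≤ t then
    f (knightTime f ε (n + 1)).toNNReal - f (knightTime f ε n).toNNReal else 0

/-- `t̄ = max {T_n : T_n ≤ t}`. -/
def lastTime (f : ℝ≥0 → ℝ) (ε : ℝ) (t : ℝ≥0) : ℝ≥0 :=
  sSup {r : ℝ≥0 | r ≤ t ∧ ∃ n, knightTime f ε n = r}

/-- `t̄⁺ = min {T_n : t̄ < T_n} ∧ T`. -/
def nextTime (f : ℝ≥0 → ℝ) (ε : ℝ) (T t : ℝ≥0) : ℝ≥0 :=
  ((⨅ (n : ℕ) (_ : (lastTime f ε t : ℝ≥0∞) < knightTime f ε n), knightTime f ε n) ⊓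
    (T : ℝ≥0∞)).toNNReal

/-- The pure jump approximation along the path `f`:
`∫_0^{t̄} ∂_s K_{H,1}(t̄,s) [A(t̄) - A(s̄⁺)] ds - ∫_0^{t̄} ∂_s K_{H,2}(t̄,s) A(s) ds`. -/
def approx (H : ℝ) (T : ℝ≥0) (f : ℝ≥0 → ℝ) (ε : ℝ) (t : ℝ≥0) : ℝ :=
  (∫ s in (0 : ℝ)..lastTime f ε t, dK₁ H (lastTime f ε t) s *
      (knightWalk f ε (lastTime f ε t) - knightWalk f ε (nextTime f ε T s.toNNReal))) -
    ∫ s in (0 : ℝ)..lastTime f ε t, dK₂ H (lastTime f ε t) s * knightWalk f ε s.toNNReal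

/-- `‖f‖_∞ = sup_{0 ≤ t ≤ T} |f t|`, as an extended nonnegative real. -/
def supNorm (T : ℝ≥0) (f : ℝ≥0 → ℝ) : ℝ≥0∞ := ⨆ (t : ℝ≥0) (_ : t ≤ T), ‖f t‖ₑ

end KnightFBM

end

/-! The estimate is pathwise up to one random Hölder constant. Both kernel derivatives are
homogeneous, `∂_s K(t, t v) = t ^ (H - 3/2) ∂_s K(1, v)`, so every integral reduces to `[0, 1]`.
There `dK₁` is too singular at `v = 1` and `dK₂` at `v = 0`, and a weight of order `b > 1/2 - H` at
the bad endpoint restores integrability.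

Let `f` be a `γ`-Hölder path with constant `M` and `τ` the last embedded time before `t`. The
approximation at `t` and `Λ_H f (τ)` are integrals of the same kernels against integrands that
differ by at most `2 ε`, and also by at most `M` times the distance to the singular endpoint to the
power `γ`. Interpolating the two bounds gives an error of order `M ε ^ η`
(`HolderPath.abs_approx_sub_Lam_le`). Moving from `τ` to `t` costs `M (t - τ) ^ (γ H)`, since `Λ_H`
maps `γ`-Hölder paths to `γ H`-Hölder ones (`HolderPath.abs_Lam_sub_le` with `b = γ (1 - H)`).

Two probabilistic inputs remain. Dyadic chaining bounds `M` by a power of `dyadSum`, whose mean is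
finite. A long gap `t - τ` forces the path to stay in a tube of radius `ε`, hence to have many
independent increments of size at most `2 ε`; the probability of this is smaller than any prescribed
power of `ε`, up to a constant (`exists_measure_stuckSet_le`). Outside this event the gap is at most
a constant times `ε ^ κ` with `κ γ H = η`; on it the trivial gap bound and Cauchy–Schwarz suffice
(`lintegral_rpow_le`). This yields every rate `0 < η < H`, and the exponent of the theorem is `p η`
for such an `η`. -/

namespace KnightFBM

/-! ### Integrals against a homogeneous kernel -/

section Homogeneous

variable {k κ w g : ℝ → ℝ} {τ α c : ℝ}

lemma intervalIntegrable_mul_of_abs_le (hκ : Measurable κ) (hg : Measurable g)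
    (hint : IntervalIntegrable (fun v => κ v * w v) volume 0 1)
    (hgw : ∀ v ∈ Set.Ioo (0 : ℝ) 1, |g v| ≤ c * w v) :
    IntervalIntegrable (fun v => κ v * g v) volume 0 1 := by
  rw [intervalIntegrable_iff_integrableOn_Ioo_of_le zero_le_one] at hint ⊢
  refine (hint.const_mul c).mono (hκ.mul hg).aestronglyMeasurable ?_
  filter_upwards [ae_restrict_mem measurableSet_Ioo] with v hv
  rw [norm_mul, norm_mul, norm_mul, mul_left_comm]
  refine mul_le_mul_of_nonneg_left ?_ (norm_nonneg _)
  rw [← norm_mul]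
  exact (hgw v hv).trans (le_abs_self _)

lemma abs_integral_mul_le
    (hint : IntervalIntegrable (fun v => κ v * w v) volume 0 1)
    (hgw : ∀ v ∈ Set.Ioo (0 : ℝ) 1, |g v| ≤ c * w v) (hc : 0 ≤ c) :
    |∫ v in (0 : ℝ)..1, κ v * g v| ≤ c * ∫ v in (0 : ℝ)..1, |κ v * w v| := by
  rw [← intervalIntegral.integral_const_mul, ← Real.norm_eq_abs]
  refine intervalIntegral.norm_integral_le_of_norm_le zero_le_one ?_ (hint.abs.const_mul c)
  filter_upwards [Measure.ae_ne volume (1 : ℝ)] with v hv1 hv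
  have hv' : v ∈ Set.Ioo (0 : ℝ) 1 := ⟨hv.1, lt_of_le_of_ne hv.2 hv1⟩
  rw [norm_mul, abs_mul, mul_left_comm]
  refine mul_le_mul_of_nonneg_left ?_ (norm_nonneg _)
  exact (hgw v hv').trans (mul_le_mul_of_nonneg_left (le_abs_self _) hc)

lemma integral_homogeneous (hτ : 0 < τ)
    (hk : ∀ v ∈ Set.Ioo (0 : ℝ) 1, k (τ * v) = τ ^ α * κ v) :
    ∫ s in (0 : ℝ)..τ, k s * g s = τ ^ (α + 1) * ∫ v in (0 : ℝ)..1, κ v * g (τ * v) := by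
  have h := intervalIntegral.smul_integral_comp_mul_left (a := 0) (b := 1)
    (f := fun s => k s * g s) τ
  simp only [mul_zero, mul_one] at h
  rw [← h, Real.rpow_add_one hτ.ne', smul_eq_mul, mul_comm (τ ^ α) τ, mul_assoc]
  congr 1
  rw [← intervalIntegral.integral_const_mul]
  refine intervalIntegral.integral_congr_ae ?_
  -- The scaling relation is only available in the open interval; the endpoint `1` is a null set.
  filter_upwards [Measure.ae_ne volume (1 : ℝ)] with v hv1 hv
  rw [Set.uIoc_of_le zero_le_one] at hv
  rw [hk v ⟨hv.1, lt_of_le_of_ne hv.2 hv1⟩, mul_assoc]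

lemma intervalIntegrable_homogeneous (hτ : 0 < τ)
    (hk : ∀ v ∈ Set.Ioo (0 : ℝ) 1, k (τ * v) = τ ^ α * κ v)
    (hint : IntervalIntegrable (fun v => κ v * g (τ * v)) volume 0 1) :
    IntervalIntegrable (fun s => k s * g s) volume 0 τ := by
  have : IntervalIntegrable (fun v => (fun s => k s * g s) (τ * v)) volume (0 / τ) (τ / τ) := by
    rw [zero_div, div_self hτ.ne']
    rw [intervalIntegrable_iff_integrableOn_Ioo_of_le zero_le_one] at hint ⊢
    refine (hint.const_mul (τ ^ α)).congr ?_
    filter_upwards [ae_restrict_mem measurableSet_Ioo] with v hv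
    simp only [hk v hv, mul_assoc]
  exact (IntervalIntegrable.comp_mul_left_iff hτ.ne').1 this

end Homogeneous

/-! ### The kernels -/

lemma intervalIntegrable_beta {p q : ℝ} (hp : -1 < p) (hq : -1 < q) :
    IntervalIntegrable (fun v : ℝ => v ^ p * (1 - v) ^ q) volume 0 1 := by
  have h := Complex.betaIntegral_convergent (u := (p + 1 : ℝ)) (v := (q + 1 : ℝ))
    (by simpa using by linarith) (by simpa using by linarith)
  rw [intervalIntegrable_iff_integrableOn_Ioo_of_le zero_le_one] at h ⊢
  refine h.re.congr ?_
  filter_upwards [ae_restrict_mem measurableSet_Ioo] with v hv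
  have h1 : (v : ℂ) ^ (((p + 1 : ℝ) : ℂ) - 1) = ((v ^ p : ℝ) : ℂ) := by
    rw [Complex.ofReal_cpow hv.1.le]; push_cast; ring_nf
  have h2 : (1 - (v : ℂ)) ^ (((q + 1 : ℝ) : ℂ) - 1) = (((1 - v) ^ q : ℝ) : ℂ) := by
    rw [Complex.ofReal_cpow (by linarith [hv.2])]; push_cast; ring_nf
  rw [h1, h2, ← Complex.ofReal_mul]
  simp

lemma K₁_mul {H t r : ℝ} (ht : 0 < t) (hr : r ∈ Set.Ioo (0 : ℝ) 1) :
    K₁ H t (t * r) = t ^ (H - 1 / 2) * K₁ H 1 r := by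
  have h1 : t - t * r = t * (1 - r) := by ring
  rw [K₁, K₁, h1, Real.mul_rpow ht.le hr.1.le, Real.mul_rpow ht.le (by linarith [hr.2]),
    Real.one_rpow]
  have : t ^ (1 / 2 - H) * t ^ (H - 1 / 2) = 1 := by
    rw [← Real.rpow_add ht]; simp
  linear_combination (cH H * t ^ (H - 1 / 2) * r ^ (1 / 2 - H) * (1 - r) ^ (H - 1 / 2)) * this

lemma integral_K₂_mul {H c s t : ℝ} (hc : 0 < c) (hs : 0 < s) (hst : s ≤ t) :
    ∫ u in (c * s)..(c * t), u ^ (H - 3 / 2) * (u - c * s) ^ (H - 1 / 2) =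
      c ^ (2 * H - 1) * ∫ u in s..t, u ^ (H - 3 / 2) * (u - s) ^ (H - 1 / 2) := by
  rw [← intervalIntegral.smul_integral_comp_mul_left, smul_eq_mul,
    ← intervalIntegral.integral_const_mul, ← intervalIntegral.integral_const_mul]
  refine intervalIntegral.integral_congr fun u hu => ?_
  rw [Set.uIcc_of_le hst] at hu
  rw [← mul_sub, Real.mul_rpow hc.le (hs.le.trans hu.1), Real.mul_rpow hc.le (by linarith [hu.1])]
  have : c ^ (2 * H - 1) = c * c ^ (H - 3 / 2) * c ^ (H - 1 / 2) := by
    nth_rewrite 2 [← Real.rpow_one c]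
    rw [← Real.rpow_add hc, ← Real.rpow_add hc]
    ring_nf
  rw [this]; ring

lemma K₂_mul {H t r : ℝ} (ht : 0 < t) (hr : r ∈ Set.Ioo (0 : ℝ) 1) :
    K₂ H t (t * r) = t ^ (H - 1 / 2) * K₂ H 1 r := by
  have h := integral_K₂_mul (H := H) ht hr.1 hr.2.le
  rw [mul_one] at h
  rw [K₂, K₂, h, Real.mul_rpow ht.le hr.1.le]
  have : t ^ (1 / 2 - H) * t ^ (2 * H - 1) = t ^ (H - 1 / 2) := by
    rw [← Real.rpow_add ht]; ring_nf
  rw [← this]; ring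

lemma deriv_mul_of_homogeneous {f g : ℝ → ℝ} {t β v : ℝ} (ht : 0 < t)
    (h : ∀ r ∈ Set.Ioo (0 : ℝ) 1, f (t * r) = t ^ β * g r) (hv : v ∈ Set.Ioo (0 : ℝ) 1) :
    deriv f (t * v) = t ^ (β - 1) * deriv g v := by
  have h1 : deriv (fun r => f (t * r)) v = t ^ β * deriv g v := by
    rw [← deriv_const_mul_field]
    refine Filter.EventuallyEq.deriv_eq ?_
    filter_upwards [isOpen_Ioo.mem_nhds hv] with r hr using h r hr
  rw [deriv_comp_mul_left, smul_eq_mul] at h1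
  rw [Real.rpow_sub_one ht.ne']
  field_simp
  linarith

lemma dK₁_mul {H t v : ℝ} (ht : 0 < t) (hv : v ∈ Set.Ioo (0 : ℝ) 1) :
    dK₁ H t (t * v) = t ^ (H - 3 / 2) * dK₁ H 1 v := by
  have := deriv_mul_of_homogeneous ht (fun r hr => K₁_mul (H := H) ht hr) hv
  rwa [show H - 1 / 2 - 1 = H - 3 / 2 by ring] at this

lemma dK₂_mul {H t v : ℝ} (ht : 0 < t) (hv : v ∈ Set.Ioo (0 : ℝ) 1) :
    dK₂ H t (t * v) = t ^ (H - 3 / 2) * dK₂ H 1 v := by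
  have := deriv_mul_of_homogeneous ht (fun r hr => K₂_mul (H := H) ht hr) hv
  rwa [show H - 1 / 2 - 1 = H - 3 / 2 by ring] at this

lemma measurable_dK₁ (H t : ℝ) : Measurable (dK₁ H t) := measurable_deriv _

lemma measurable_dK₂ (H t : ℝ) : Measurable (dK₂ H t) := measurable_deriv _

/-- The two terms of the product rule share the factor `v ^ (-1/2 - H) (1 - v) ^ (H - 3/2)`, and
their remaining factors `1 - v` and `v` add up to `1`. The exponent `H - 3/2 < -1` is why increments
of the path, not values, must be integrated. -/
lemma dK₁_one {H v : ℝ} (hv : v ∈ Set.Ioo (0 : ℝ) 1) :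
    dK₁ H 1 v = cH H * (1 / 2 - H) * (v ^ (-1 / 2 - H) * (1 - v) ^ (H - 3 / 2)) := by
  have hv1 : 0 < 1 - v := by linarith [hv.2]
  have h1 : HasDerivAt (fun r : ℝ => r ^ (1 / 2 - H)) ((1 / 2 - H) * v ^ (1 / 2 - H - 1)) v :=
    Real.hasDerivAt_rpow_const (Or.inl hv.1.ne')
  have h2 : HasDerivAt (fun r : ℝ => (1 - r) ^ (H - 1 / 2))
      (-1 * (H - 1 / 2) * (1 - v) ^ (H - 1 / 2 - 1)) v :=
    ((hasDerivAt_id v).const_sub 1).rpow_const (Or.inl hv1.ne')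
  have h3 := (h1.mul h2).const_mul (cH H)
  have h4 : HasDerivAt (fun r => K₁ H 1 r) _ v :=
    h3.congr_of_eventuallyEq (.of_eq (by ext r; simp [K₁, mul_assoc]))
  rw [dK₁, h4.deriv]
  have e1 : v ^ (1 / 2 - H) = v ^ (-1 / 2 - H) * v := by
    rw [← Real.rpow_add_one hv.1.ne']; ring_nf
  have e2 : (1 - v) ^ (H - 1 / 2) = (1 - v) ^ (H - 3 / 2) * (1 - v) := by
    rw [← Real.rpow_add_one hv1.ne']; ring_nf
  rw [show 1 / 2 - H - 1 = -1 / 2 - H by ring, show H - 1 / 2 - 1 = H - 3 / 2 by ring, e1, e2]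
  ring

lemma intervalIntegrable_dK₁_mul {H b : ℝ} (hH : H < 1 / 2) (hb : 1 / 2 - H < b) :
    IntervalIntegrable (fun v => dK₁ H 1 v * (1 - v) ^ b) volume 0 1 := by
  have h := (intervalIntegrable_beta (p := -1 / 2 - H) (q := H - 3 / 2 + b) (by linarith)
    (by linarith)).const_mul (cH H * (1 / 2 - H))
  rw [intervalIntegrable_iff_integrableOn_Ioo_of_le zero_le_one] at h ⊢
  refine h.congr ?_
  filter_upwards [ae_restrict_mem measurableSet_Ioo] with v hv
  rw [dK₁_one hv, Real.rpow_add (by linarith [hv.2])]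
  ring

/-- The function `G x = ∫ u in 1..x, u ^ (H - 3/2) (u - 1) ^ (H - 1/2)`. -/
noncomputable def tailK₂ (H x : ℝ) : ℝ := ∫ u in (1 : ℝ)..x, u ^ (H - 3 / 2) * (u - 1) ^ (H - 1 / 2)

/-- Near `1` the factor `(u - 1) ^ (H - 1/2)` is integrable and the other is at most `1`; beyond `2`
the roles are exchanged. -/
lemma integrableOn_tailK₂ {H : ℝ} (hH0 : 0 < H) (hH : H < 1 / 2) :
    IntegrableOn (fun u : ℝ => u ^ (H - 3 / 2) * (u - 1) ^ (H - 1 / 2)) (Set.Ioi 1) := by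
  have hm : Measurable (fun u : ℝ => u ^ (H - 3 / 2) * (u - 1) ^ (H - 1 / 2)) := by fun_prop
  rw [← Set.Ioc_union_Ioi_eq_Ioi (show (1 : ℝ) ≤ 2 by norm_num)]
  refine IntegrableOn.union ?_ ?_
  · have h : IntervalIntegrable (fun u : ℝ => (u - 1) ^ (H - 1 / 2)) volume 1 2 := by
      have := (intervalIntegral.intervalIntegrable_rpow' (a := 0) (b := 1)
        (r := H - 1 / 2) (by linarith)).comp_sub_right 1
      norm_num at this ⊢
      exact this
    rw [intervalIntegrable_iff_integrableOn_Ioc_of_le (by norm_num)] at h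
    refine Integrable.mono h hm.aestronglyMeasurable ?_
    filter_upwards [ae_restrict_mem measurableSet_Ioc] with u hu
    rw [norm_mul]
    refine mul_le_of_le_one_left (norm_nonneg _) ?_
    rw [Real.norm_of_nonneg (Real.rpow_nonneg (by linarith [hu.1]) _)]
    exact Real.rpow_le_one_of_one_le_of_nonpos hu.1.le (by linarith)
  · have h := integrableOn_Ioi_rpow_of_lt (a := H - 3 / 2) (by linarith) (show (0 : ℝ) < 2 by norm_num)
    refine Integrable.mono h hm.aestronglyMeasurable ?_
    filter_upwards [ae_restrict_mem measurableSet_Ioi] with u hu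
    rw [Set.mem_Ioi] at hu
    rw [norm_mul]
    refine mul_le_of_le_one_right (norm_nonneg _) ?_
    rw [Real.norm_of_nonneg (Real.rpow_nonneg (by linarith) _)]
    exact Real.rpow_le_one_of_one_le_of_nonpos (by linarith) (by linarith)

lemma tailK₂_nonneg {H x : ℝ} (hx : 1 ≤ x) : 0 ≤ tailK₂ H x :=
  intervalIntegral.integral_nonneg hx fun u hu =>
    mul_nonneg (Real.rpow_nonneg (by linarith [hu.1]) _) (Real.rpow_nonneg (by linarith [hu.1]) _)

lemma tailK₂_le {H x : ℝ} (hH0 : 0 < H) (hH : H < 1 / 2) (hx : 1 ≤ x) :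
    tailK₂ H x ≤ ∫ u in Set.Ioi (1 : ℝ), u ^ (H - 3 / 2) * (u - 1) ^ (H - 1 / 2) := by
  rw [tailK₂, intervalIntegral.integral_of_le hx]
  refine setIntegral_mono_set (integrableOn_tailK₂ hH0 hH) ?_
    (Set.Ioc_subset_Ioi_self).eventuallyLE
  filter_upwards [ae_restrict_mem measurableSet_Ioi] with u hu
  rw [Set.mem_Ioi] at hu
  exact mul_nonneg (Real.rpow_nonneg (by linarith) _) (Real.rpow_nonneg (by linarith) _)

lemma hasDerivAt_tailK₂ {H x : ℝ} (hH0 : 0 < H) (hH : H < 1 / 2) (hx : 1 < x) :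
    HasDerivAt (tailK₂ H) (x ^ (H - 3 / 2) * (x - 1) ^ (H - 1 / 2)) x := by
  have hm : Measurable (fun u : ℝ => u ^ (H - 3 / 2) * (u - 1) ^ (H - 1 / 2)) := by fun_prop
  refine intervalIntegral.integral_hasDerivAt_right ?_
    (hm.stronglyMeasurable.stronglyMeasurableAtFilter) ?_
  · rw [intervalIntegrable_iff_integrableOn_Ioc_of_le hx.le]
    exact (integrableOn_tailK₂ hH0 hH).mono_set Set.Ioc_subset_Ioi_self
  · exact (continuousAt_id.rpow_const (Or.inl (by simp; linarith))).mul
      ((continuousAt_id.sub continuousAt_const).rpow_const (Or.inl (by simp; linarith)))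

/-- The substitution `u ↦ r u` moves the dependence on `r` from the singular integrand to the upper
limit, so that the derivative follows from the fundamental theorem of calculus. -/
lemma K₂_one {H r : ℝ} (hr : r ∈ Set.Ioo (0 : ℝ) 1) :
    K₂ H 1 r = cH H * (1 / 2 - H) * (r ^ (H - 1 / 2) * tailK₂ H r⁻¹) := by
  have h := integral_K₂_mul (H := H) (t := r⁻¹) hr.1 one_pos (by
    exact (one_le_inv₀ hr.1).2 hr.2.le)
  rw [mul_inv_cancel₀ hr.1.ne', mul_one] at h
  rw [K₂, h, tailK₂]
  have : r ^ (1 / 2 - H) * r ^ (2 * H - 1) = r ^ (H - 1 / 2) := by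
    rw [← Real.rpow_add hr.1]; ring_nf
  rw [← this]; ring

lemma dK₂_one {H v : ℝ} (hH0 : 0 < H) (hH : H < 1 / 2) (hv : v ∈ Set.Ioo (0 : ℝ) 1) :
    dK₂ H 1 v = cH H * (1 / 2 - H) * ((H - 1 / 2) * v ^ (H - 3 / 2) * tailK₂ H v⁻¹ -
      v ^ (-1 / 2 - H) * (1 - v) ^ (H - 1 / 2)) := by
  have hv1 : 0 < 1 - v := by linarith [hv.2]
  have h1 : HasDerivAt (fun r : ℝ => r ^ (H - 1 / 2)) ((H - 1 / 2) * v ^ (H - 1 / 2 - 1)) v :=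
    Real.hasDerivAt_rpow_const (Or.inl hv.1.ne')
  have h2 := (hasDerivAt_tailK₂ hH0 hH ((one_lt_inv₀ hv.1).2 hv.2)).comp v
    (hasDerivAt_inv hv.1.ne')
  have h3 := (h1.mul h2).const_mul (cH H * (1 / 2 - H))
  have h4 : HasDerivAt (fun r => K₂ H 1 r) _ v := h3.congr_of_eventuallyEq (by
    filter_upwards [isOpen_Ioo.mem_nhds hv] with r hr using K₂_one hr)
  rw [dK₂, h4.deriv]
  have e1 : v⁻¹ - 1 = (1 - v) * v⁻¹ := by
    have := hv.1.ne'
    field_simp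
  have e2 : v ^ (-1 / 2 - H) = v ^ (H - 1 / 2) * ((v ^ (H - 3 / 2))⁻¹ * (v ^ (H - 1 / 2))⁻¹ *
      (v ^ (2 : ℝ))⁻¹) := by
    rw [← Real.rpow_neg hv.1.le, ← Real.rpow_neg hv.1.le, ← Real.rpow_neg hv.1.le,
      ← Real.rpow_add hv.1, ← Real.rpow_add hv.1, ← Real.rpow_add hv.1]
    ring_nf
  rw [e1, Real.mul_rpow hv1.le (inv_nonneg.2 hv.1.le), Real.inv_rpow hv.1.le,
    Real.inv_rpow hv.1.le, e2, show H - 1 / 2 - 1 = H - 3 / 2 by ring, Real.rpow_two,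
    Function.comp_apply]
  ring

/-- Since `tailK₂` is bounded by its integral over the half-line, the worst singularity is `v ^ (H -
3/2)` at `0`; the singularity `(1 - v) ^ (H - 1/2)` at `1` is already integrable. -/
lemma intervalIntegrable_dK₂_mul {H b : ℝ} (hH0 : 0 < H) (hH : H < 1 / 2) (hb : 1 / 2 - H < b) :
    IntervalIntegrable (fun v => dK₂ H 1 v * v ^ b) volume 0 1 := by
  set M := ∫ u in Set.Ioi (1 : ℝ), u ^ (H - 3 / 2) * (u - 1) ^ (H - 1 / 2)
  have h1 := (intervalIntegral.intervalIntegrable_rpow' (a := 0) (b := 1)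
    (r := H - 3 / 2 + b) (by linarith)).const_mul ((1 / 2 - H) * M)
  have h2 := intervalIntegrable_beta (p := -1 / 2 - H + b) (q := H - 1 / 2) (by linarith)
    (by linarith)
  have h := (h1.add h2).const_mul (cH H * (1 / 2 - H))
  have hc : 0 ≤ cH H := Real.sqrt_nonneg _
  rw [intervalIntegrable_iff_integrableOn_Ioo_of_le zero_le_one] at h ⊢
  refine Integrable.mono h ((measurable_dK₂ H 1).mul (by fun_prop)).aestronglyMeasurable ?_
  filter_upwards [ae_restrict_mem measurableSet_Ioo] with v hv
  have hv1 : 0 < 1 - v := by linarith [hv.2]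
  have hG0 := tailK₂_nonneg (H := H) ((one_le_inv₀ hv.1).2 hv.2.le)
  have hG := tailK₂_le hH0 hH ((one_le_inv₀ hv.1).2 hv.2.le)
  have p1 := Real.rpow_nonneg hv.1.le (H - 3 / 2)
  have p2 := Real.rpow_nonneg hv.1.le (-1 / 2 - H)
  have p3 := Real.rpow_nonneg hv.1.le b
  have p4 := Real.rpow_nonneg hv1.le (H - 1 / 2)
  rw [dK₂_one hH0 hH hv, Real.rpow_add hv.1, Real.rpow_add hv.1]
  have hle : |(H - 1 / 2) * v ^ (H - 3 / 2) * tailK₂ H v⁻¹ - v ^ (-1 / 2 - H) *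
      (1 - v) ^ (H - 1 / 2)| ≤
      (1 / 2 - H) * v ^ (H - 3 / 2) * M + v ^ (-1 / 2 - H) * (1 - v) ^ (H - 1 / 2) := by
    have q0 := mul_nonneg (show 0 ≤ 1 / 2 - H by linarith) p1
    have q1 := mul_nonneg q0 hG0
    have q2 := mul_le_mul_of_nonneg_left hG q0
    have q3 := mul_nonneg p2 p4
    rw [abs_le]
    constructor <;> linarith
  refine le_trans ?_ (le_abs_self _)
  rw [Real.norm_eq_abs, abs_mul, abs_mul, abs_of_nonneg p3,
    abs_of_nonneg (mul_nonneg hc (by linarith)), mul_assoc (cH H * (1 / 2 - H))]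
  refine mul_le_mul_of_nonneg_left ?_ (mul_nonneg hc (by linarith))
  refine (mul_le_mul_of_nonneg_right hle p3).trans (le_of_eq ?_)
  ring

/-! ### The operator `Λ_H` on Hölder paths -/

lemma le_rpow_mul_rpow {x X Y θ : ℝ} (hx : 0 ≤ x) (hX : x ≤ X) (hY : x ≤ Y) (h0 : 0 ≤ θ)
    (h1 : θ ≤ 1) : x ≤ X ^ (1 - θ) * Y ^ θ := by
  calc x = x ^ (1 - θ) * x ^ θ := by
        rw [← Real.rpow_add' hx (by simp)]; simp
    _ ≤ _ := mul_le_mul (Real.rpow_le_rpow hx hX (by linarith)) (Real.rpow_le_rpow hx hY h0)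
        (Real.rpow_nonneg hx _) (Real.rpow_nonneg (hx.trans hX) _)

/-- The weighted mass `∫ |∂_s K_{H,1}(1, v)| (1 - v)^b dv`. -/
noncomputable def mass₁ (H b : ℝ) : ℝ := ∫ v in (0 : ℝ)..1, |dK₁ H 1 v * (1 - v) ^ b|

/-- The weighted mass `∫ |∂_s K_{H,2}(1, v)| v^b dv`. -/
noncomputable def mass₂ (H b : ℝ) : ℝ := ∫ v in (0 : ℝ)..1, |dK₂ H 1 v * v ^ b|

lemma mass₁_nonneg (H b : ℝ) : 0 ≤ mass₁ H b :=
  intervalIntegral.integral_nonneg zero_le_one fun _ _ => abs_nonneg _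

lemma mass₂_nonneg (H b : ℝ) : 0 ≤ mass₂ H b :=
  intervalIntegral.integral_nonneg zero_le_one fun _ _ => abs_nonneg _

section Bounds

variable {H b c τ : ℝ} {e : ℝ → ℝ}

lemma bound_dK₁ (hH : H < 1 / 2) (hb : 1 / 2 - H < b) (hτ : 0 < τ) (hc : 0 ≤ c)
    (he : Measurable e) (hle : ∀ s ∈ Set.Ioo 0 τ, |e s| ≤ c * (τ - s) ^ b) :
    IntervalIntegrable (fun s => dK₁ H τ s * e s) volume 0 τ ∧
      |∫ s in (0 : ℝ)..τ, dK₁ H τ s * e s| ≤ c * τ ^ (H - 1 / 2 + b) * mass₁ H b := by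
  have hw : ∀ v ∈ Set.Ioo (0 : ℝ) 1, |e (τ * v)| ≤ c * τ ^ b * (1 - v) ^ b := fun v hv => by
    have := hle (τ * v) ⟨mul_pos hτ hv.1, by nlinarith [hv.2]⟩
    rwa [show τ - τ * v = τ * (1 - v) by ring, Real.mul_rpow hτ.le (by linarith [hv.2]),
      ← mul_assoc] at this
  have hk : ∀ v ∈ Set.Ioo (0 : ℝ) 1, dK₁ H τ (τ * v) = τ ^ (H - 3 / 2) * dK₁ H 1 v :=
    fun v hv => dK₁_mul hτ hv
  have hm : Measurable fun v => e (τ * v) := he.comp (measurable_const_mul τ)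
  have hint := intervalIntegrable_dK₁_mul hH hb
  refine ⟨intervalIntegrable_homogeneous hτ hk
    (intervalIntegrable_mul_of_abs_le (measurable_dK₁ H 1) hm hint hw), ?_⟩
  rw [integral_homogeneous hτ hk, abs_mul, abs_of_nonneg (Real.rpow_nonneg hτ.le _)]
  refine (mul_le_mul_of_nonneg_left (abs_integral_mul_le hint hw (mul_nonneg hc
    (Real.rpow_nonneg hτ.le _))) (Real.rpow_nonneg hτ.le _)).trans (le_of_eq ?_)
  rw [show H - 1 / 2 + b = H - 3 / 2 + 1 + b by ring, Real.rpow_add hτ (H - 3 / 2 + 1), mass₁]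
  ring

lemma bound_dK₂ (hH0 : 0 < H) (hH : H < 1 / 2) (hb : 1 / 2 - H < b) (hτ : 0 < τ) (hc : 0 ≤ c)
    (he : Measurable e) (hle : ∀ s ∈ Set.Ioo 0 τ, |e s| ≤ c * s ^ b) :
    IntervalIntegrable (fun s => dK₂ H τ s * e s) volume 0 τ ∧
      |∫ s in (0 : ℝ)..τ, dK₂ H τ s * e s| ≤ c * τ ^ (H - 1 / 2 + b) * mass₂ H b := by
  have hw : ∀ v ∈ Set.Ioo (0 : ℝ) 1, |e (τ * v)| ≤ c * τ ^ b * v ^ b := fun v hv => by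
    have := hle (τ * v) ⟨mul_pos hτ hv.1, by nlinarith [hv.2]⟩
    rwa [Real.mul_rpow hτ.le hv.1.le, ← mul_assoc] at this
  have hk : ∀ v ∈ Set.Ioo (0 : ℝ) 1, dK₂ H τ (τ * v) = τ ^ (H - 3 / 2) * dK₂ H 1 v :=
    fun v hv => dK₂_mul hτ hv
  have hm : Measurable fun v => e (τ * v) := he.comp (measurable_const_mul τ)
  have hint := intervalIntegrable_dK₂_mul hH0 hH hb
  refine ⟨intervalIntegrable_homogeneous hτ hk
    (intervalIntegrable_mul_of_abs_le (measurable_dK₂ H 1) hm hint hw), ?_⟩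
  rw [integral_homogeneous hτ hk, abs_mul, abs_of_nonneg (Real.rpow_nonneg hτ.le _)]
  refine (mul_le_mul_of_nonneg_left (abs_integral_mul_le hint hw (mul_nonneg hc
    (Real.rpow_nonneg hτ.le _))) (Real.rpow_nonneg hτ.le _)).trans (le_of_eq ?_)
  rw [show H - 1 / 2 + b = H - 3 / 2 + 1 + b by ring, Real.rpow_add hτ (H - 3 / 2 + 1), mass₂]
  ring

end Bounds

/-- `f` is `γ`-Hölder continuous on `[0, T]` with constant `M`. -/
def HolderPath (T : ℝ≥0) (γ M : ℝ) (f : ℝ≥0 → ℝ) : Prop :=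
  ∀ s t : ℝ≥0, s ≤ t → t ≤ T → |f t - f s| ≤ M * ((t : ℝ) - s) ^ γ

lemma HolderPath.real {T : ℝ≥0} {γ M : ℝ} {f : ℝ≥0 → ℝ} (hf : HolderPath T γ M f) {s t : ℝ}
    (hs : 0 ≤ s) (hst : s ≤ t) (ht : t ≤ T) :
    |f t.toNNReal - f s.toNNReal| ≤ M * (t - s) ^ γ := by
  have := hf s.toNNReal t.toNNReal (Real.toNNReal_le_toNNReal hst)
    (Real.toNNReal_le_iff_le_coe.2 ht)
  rwa [Real.coe_toNNReal _ hs, Real.coe_toNNReal _ (hs.trans hst)] at this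

/-- The profile `Φ` with `Λ_H f (t) = t ^ (H - 1/2) Φ(t)`. -/
noncomputable def profile (H : ℝ) (f : ℝ≥0 → ℝ) (t : ℝ≥0) : ℝ :=
  (∫ v in (0 : ℝ)..1, dK₁ H 1 v * (f t - f (t * v).toNNReal)) -
    ∫ v in (0 : ℝ)..1, dK₂ H 1 v * f (t * v).toNNReal

lemma Lam_eq_profile (H : ℝ) (f : ℝ≥0 → ℝ) {t : ℝ≥0} (ht : 0 < t) :
    Lam H f t = (t : ℝ) ^ (H - 1 / 2) * profile H f t := by
  have ht' : (0 : ℝ) < t := ht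
  have h1 := integral_homogeneous (α := H - 3 / 2) (k := dK₁ H t) (κ := dK₁ H 1)
    (g := fun s => f t - f s.toNNReal) ht' (fun v hv => dK₁_mul ht' hv)
  have h2 := integral_homogeneous (α := H - 3 / 2) (k := dK₂ H t) (κ := dK₂ H 1)
    (g := fun s => f s.toNNReal) ht' (fun v hv => dK₂_mul ht' hv)
  have h3 : H - 3 / 2 + 1 = H - 1 / 2 := by ring
  rw [h3] at h1 h2
  rw [Lam, profile, h2, mul_sub, ← h1]
  simp only [mul_comm]

@[simp] lemma Lam_zero (H : ℝ) (f : ℝ≥0 → ℝ) : Lam H f 0 = 0 := by simp [Lam]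

section Holder

variable {H γ M b : ℝ} {T : ℝ≥0} {f : ℝ≥0 → ℝ}

lemma HolderPath.abs_increment_le (hf : HolderPath T γ M f) {t : ℝ≥0}
    (ht : t ≤ T) {v : ℝ} (hv : v ∈ Set.Ioo (0 : ℝ) 1) :
    |f t - f (t * v).toNNReal| ≤ M * (t : ℝ) ^ γ * (1 - v) ^ γ := by
  have h := hf.real (s := t * v) (t := t) (mul_nonneg t.coe_nonneg hv.1.le)
    (mul_le_of_le_one_right t.coe_nonneg hv.2.le) ht
  rwa [Real.toNNReal_coe, show (t : ℝ) - t * v = t * (1 - v) by ring,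
    Real.mul_rpow t.coe_nonneg (by linarith [hv.2]), ← mul_assoc] at h

lemma HolderPath.abs_value_le (hf : HolderPath T γ M f) (hf0 : f 0 = 0) {t : ℝ≥0}
    (ht : t ≤ T) {v : ℝ} (hv : v ∈ Set.Ioo (0 : ℝ) 1) :
    |f (t * v).toNNReal| ≤ M * (t : ℝ) ^ γ * v ^ γ := by
  have ht' : (t : ℝ) ≤ T := ht
  have h := hf.real (s := 0) (t := t * v) le_rfl (mul_nonneg t.coe_nonneg hv.1.le)
    ((mul_le_of_le_one_right t.coe_nonneg hv.2.le).trans ht')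
  rwa [Real.toNNReal_zero, hf0, sub_zero, sub_zero, Real.mul_rpow t.coe_nonneg hv.1.le, ← mul_assoc] at h

lemma HolderPath.integrable₁ (hf : HolderPath T γ M f) (hc : Continuous f)
    (hH : H < 1 / 2) (hγ : 1 / 2 - H < γ) {t : ℝ≥0} (ht : t ≤ T) :
    IntervalIntegrable (fun v => dK₁ H 1 v * (f t - f (t * v).toNNReal)) volume 0 1 :=
  intervalIntegrable_mul_of_abs_le (measurable_dK₁ H 1) (by
    have : Continuous fun v : ℝ => f t - f (t * v).toNNReal := by fun_prop
    exact this.measurable) (intervalIntegrable_dK₁_mul hH hγ)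
    (fun v hv => hf.abs_increment_le ht hv)

lemma HolderPath.integrable₂ (hf : HolderPath T γ M f) (hc : Continuous f) (hf0 : f 0 = 0)
    (hH0 : 0 < H) (hH : H < 1 / 2) (hγ : 1 / 2 - H < γ) {t : ℝ≥0} (ht : t ≤ T) :
    IntervalIntegrable (fun v => dK₂ H 1 v * f (t * v).toNNReal) volume 0 1 :=
  intervalIntegrable_mul_of_abs_le (measurable_dK₂ H 1) (by
    have : Continuous fun v : ℝ => f (t * v).toNNReal := by fun_prop
    exact this.measurable) (intervalIntegrable_dK₂_mul hH0 hH hγ)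
    (fun v hv => hf.abs_value_le hf0 ht hv)

lemma HolderPath.abs_profile_le (hf : HolderPath T γ M f) (hf0 : f 0 = 0)
    (hM : 0 ≤ M) (hH0 : 0 < H) (hH : H < 1 / 2) (hγ : 1 / 2 - H < γ) {t : ℝ≥0} (ht : t ≤ T) :
    |profile H f t| ≤ M * (t : ℝ) ^ γ * (mass₁ H γ + mass₂ H γ) := by
  have hp : 0 ≤ M * (t : ℝ) ^ γ := mul_nonneg hM (Real.rpow_nonneg t.coe_nonneg _)
  refine (abs_sub _ _).trans ?_
  rw [mul_add]
  exact add_le_add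
    (abs_integral_mul_le (intervalIntegrable_dK₁_mul hH hγ)
      (fun v hv => hf.abs_increment_le ht hv) hp)
    (abs_integral_mul_le (intervalIntegrable_dK₂_mul hH0 hH hγ)
      (fun v hv => hf.abs_value_le hf0 ht hv) hp)

lemma HolderPath.abs_profile_sub_le (hf : HolderPath T γ M f) (hc : Continuous f) (hf0 : f 0 = 0)
    (hM : 0 ≤ M) (hH0 : 0 < H) (hH : H < 1 / 2) (hb : 1 / 2 - H < b) (hbγ : b < γ)
    {r t : ℝ≥0} (hrt : r ≤ t) (ht : t ≤ T) :
    |profile H f t - profile H f r| ≤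
      2 * M * ((t : ℝ) - r) ^ (γ - b) * (t : ℝ) ^ b * mass₁ H b +
        M * ((t : ℝ) - r) ^ γ * mass₂ H γ := by
  have hγ : 1 / 2 - H < γ := hb.trans hbγ
  have hγ0 : 0 < γ := by linarith
  have hrt' : (r : ℝ) ≤ t := hrt
  have ht' : (t : ℝ) ≤ T := ht
  have hd : (0 : ℝ) ≤ t - r := by linarith
  have hr := hrt.trans ht
  have e1 : profile H f t - profile H f r =
      (∫ v in (0 : ℝ)..1, dK₁ H 1 v * ((f t - f (t * v).toNNReal) - (f r - f (r * v).toNNReal))) -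
        ∫ v in (0 : ℝ)..1, dK₂ H 1 v * (f (t * v).toNNReal - f (r * v).toNNReal) := by
    simp only [mul_sub (dK₁ H 1 _) (f t - _), mul_sub (dK₂ H 1 _)]
    rw [intervalIntegral.integral_sub (hf.integrable₁ hc hH hγ ht) (hf.integrable₁ hc hH hγ hr),
      intervalIntegral.integral_sub (hf.integrable₂ hc hf0 hH0 hH hγ ht)
        (hf.integrable₂ hc hf0 hH0 hH hγ hr), profile, profile]
    ring
  have e2 : ∀ v ∈ Set.Ioo (0 : ℝ) 1, |f (t * v).toNNReal - f (r * v).toNNReal| ≤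
      M * ((t : ℝ) - r) ^ γ * v ^ γ := fun v hv => by
    have h := hf.real (s := r * v) (t := t * v) (mul_nonneg r.coe_nonneg hv.1.le)
      (mul_le_mul_of_nonneg_right hrt' hv.1.le) ((mul_le_of_le_one_right t.coe_nonneg hv.2.le).trans ht')
    rwa [← sub_mul, Real.mul_rpow hd hv.1.le, ← mul_assoc] at h
  have e3 : ∀ v ∈ Set.Ioo (0 : ℝ) 1,
      |(f t - f (t * v).toNNReal) - (f r - f (r * v).toNNReal)| ≤
        2 * M * ((t : ℝ) - r) ^ (γ - b) * (t : ℝ) ^ b * (1 - v) ^ b := fun v hv => by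
    have hv1 : 0 ≤ 1 - v := by linarith [hv.2]
    have i1 : |(f t - f (t * v).toNNReal) - (f r - f (r * v).toNNReal)| ≤
        2 * M * ((t : ℝ) - r) ^ γ := by
      rw [sub_sub_sub_comm]
      refine (abs_sub _ _).trans ?_
      have k1 := hf r t hrt ht
      have k2 := (e2 v hv).trans (mul_le_of_le_one_right (mul_nonneg hM (Real.rpow_nonneg hd _))
        (Real.rpow_le_one hv.1.le hv.2.le hγ0.le))
      linarith
    have i2 : |(f t - f (t * v).toNNReal) - (f r - f (r * v).toNNReal)| ≤
        2 * M * ((t : ℝ) * (1 - v)) ^ γ := by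
      refine (abs_sub _ _).trans ?_
      have k1 := hf.abs_increment_le ht hv
      have k2 := hf.abs_increment_le hr hv
      have k3 : M * (r : ℝ) ^ γ * (1 - v) ^ γ ≤ M * (t : ℝ) ^ γ * (1 - v) ^ γ :=
        mul_le_mul_of_nonneg_right (mul_le_mul_of_nonneg_left
          (Real.rpow_le_rpow r.coe_nonneg hrt' hγ0.le) hM) (Real.rpow_nonneg hv1 _)
      rw [Real.mul_rpow t.coe_nonneg hv1]
      linarith
    -- The double increment is small both because `t - r` is small (`i1`) and because `v` is near
    -- `1` (`i2`). The weight `θ = b / γ` keeps exactly the power `(1 - v) ^ b` that the kernel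
    -- needs and leaves `(t - r) ^ (γ - b)`.
    have hθ0 : 0 ≤ b / γ := div_nonneg (by linarith) hγ0.le
    have hθ1 : b / γ ≤ 1 := (div_le_one hγ0).2 hbγ.le
    refine (le_rpow_mul_rpow (abs_nonneg _) i1 i2 hθ0 hθ1).trans (le_of_eq ?_)
    have hM2 : 0 ≤ 2 * M := by linarith
    rw [Real.mul_rpow hM2 (Real.rpow_nonneg hd _), Real.mul_rpow hM2 (Real.rpow_nonneg
      (mul_nonneg t.coe_nonneg hv1) _), ← Real.rpow_mul hd, ← Real.rpow_mul (mul_nonneg t.coe_nonneg hv1),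
      mul_div_cancel₀ _ hγ0.ne', mul_sub, mul_div_cancel₀ _ hγ0.ne', Real.mul_rpow t.coe_nonneg hv1, mul_one]
    have : (2 * M) ^ (1 - b / γ) * (2 * M) ^ (b / γ) = 2 * M := by
      rw [← Real.rpow_add' hM2 (by simp)]; simp
    linear_combination (((t : ℝ) - r) ^ (γ - b) * (t : ℝ) ^ b * (1 - v) ^ b) * this
  rw [e1]
  refine (abs_sub _ _).trans (add_le_add ?_ ?_)
  · exact abs_integral_mul_le (intervalIntegrable_dK₁_mul hH hb) e3
      (mul_nonneg (mul_nonneg (by linarith) (Real.rpow_nonneg hd _)) (Real.rpow_nonneg t.coe_nonneg _))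
  · exact abs_integral_mul_le (intervalIntegrable_dK₂_mul hH0 hH hγ) e2
      (mul_nonneg hM (Real.rpow_nonneg hd _))

/-- With `x = r / t` the left side is `r ^ (γ - a) (1 - x ^ a)`, and `1 - x ^ a ≤ 1 - x ≤ (1 - x) ^
(γ - a)` because `a` and `γ - a` are at most `1`. -/
lemma rpow_mul_rpow_neg_sub_le {a γ r t : ℝ} (ha0 : 0 < a) (ha1 : a ≤ 1) (haγ : a < γ)
    (hγ : γ ≤ 1) (hr : 0 < r) (hrt : r ≤ t) :
    |t ^ (-a) - r ^ (-a)| * r ^ γ ≤ (t - r) ^ (γ - a) := by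
  have ht : 0 < t := hr.trans_le hrt
  have h1 : t ^ (-a) ≤ r ^ (-a) := Real.rpow_le_rpow_of_nonpos hr hrt (by linarith)
  have hq : 0 < r / t := div_pos hr ht
  have hq1 : r / t ≤ 1 := (div_le_one ht).2 hrt
  rw [abs_sub_comm, abs_of_nonneg (by linarith)]
  have e1 : (r ^ (-a) - t ^ (-a)) * r ^ γ = r ^ (γ - a) * (1 - (r / t) ^ a) := by
    rw [Real.div_rpow hr.le ht.le, Real.rpow_sub hr, Real.rpow_neg hr.le, Real.rpow_neg ht.le]
    have := (Real.rpow_pos_of_pos hr a).ne'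
    have := (Real.rpow_pos_of_pos ht a).ne'
    field_simp
  have e2 : r / t ≤ (r / t) ^ a := by
    simpa using Real.rpow_le_rpow_of_exponent_ge hq hq1 ha1
  have e3 : 1 - r / t ≤ (1 - r / t) ^ (γ - a) := by
    rcases (sub_nonneg.2 hq1).eq_or_lt with h | h
    · rw [← h]; exact Real.rpow_nonneg le_rfl _
    · simpa using Real.rpow_le_rpow_of_exponent_ge h (by linarith) (show γ - a ≤ 1 by linarith)
  have e4 : t - r = t * (1 - r / t) := by field_simp
  rw [e1, e4, Real.mul_rpow ht.le (by linarith)]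
  exact mul_le_mul (Real.rpow_le_rpow hr.le hrt (by linarith)) (by linarith) (by
    have := Real.rpow_le_one hq.le hq1 ha0.le
    linarith) (Real.rpow_nonneg ht.le _)

/-- `Λ_H` maps `γ`-Hölder paths to `(γ - b)`-Hölder paths for `1/2 - H < b < γ`. -/
lemma HolderPath.abs_Lam_sub_le (hf : HolderPath T γ M f) (hc : Continuous f) (hf0 : f 0 = 0)
    (hM : 0 ≤ M) (hH0 : 0 < H) (hH : H < 1 / 2) (hb : 1 / 2 - H < b) (hbγ : b < γ) (hγ1 : γ ≤ 1)
    {r t : ℝ≥0} (hrt : r ≤ t) (ht : t ≤ T) :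
    |Lam H f t - Lam H f r| ≤
      (T : ℝ) ^ (b - (1 / 2 - H)) * (2 * mass₁ H b + mass₁ H γ + 2 * mass₂ H γ) *
        M * ((t : ℝ) - r) ^ (γ - b) := by
  have hγ : 1 / 2 - H < γ := hb.trans hbγ
  have hrt' : (r : ℝ) ≤ t := hrt
  have ht' : (t : ℝ) ≤ T := ht
  have m1 := mass₁_nonneg H b
  have m2 := mass₁_nonneg H γ
  have m3 := mass₂_nonneg H γ
  have hTb := Real.rpow_nonneg T.coe_nonneg (b - (1 / 2 - H))
  rcases hrt.eq_or_lt with rfl | hlt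
  · simp only [sub_self, abs_zero]
    positivity
  have hlt' : (r : ℝ) < t := hlt
  have ht0 : (0 : ℝ) < t := lt_of_le_of_lt r.coe_nonneg hlt'
  have hd : (0 : ℝ) < t - r := by linarith
  have hdp := Real.rpow_nonneg hd.le (γ - b)
  have key : ((t : ℝ) - r) ^ (γ - (1 / 2 - H)) ≤
      (T : ℝ) ^ (b - (1 / 2 - H)) * ((t : ℝ) - r) ^ (γ - b) := by
    rw [show γ - (1 / 2 - H) = (b - (1 / 2 - H)) + (γ - b) by ring, Real.rpow_add hd]
    refine mul_le_mul_of_nonneg_right (Real.rpow_le_rpow hd.le ?_ (by linarith)) hdp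
    linarith [r.coe_nonneg]
  rcases eq_or_ne r 0 with rfl | hr0
  · rw [Lam_zero, sub_zero, Lam_eq_profile H f ht0, abs_mul,
      abs_of_nonneg (Real.rpow_nonneg t.coe_nonneg _)]
    rw [NNReal.coe_zero, sub_zero] at key ⊢
    refine (mul_le_mul_of_nonneg_left (hf.abs_profile_le hf0 hM hH0 hH hγ ht)
      (Real.rpow_nonneg t.coe_nonneg _)).trans ?_
    rw [show (t : ℝ) ^ (H - 1 / 2) * (M * (t : ℝ) ^ γ * (mass₁ H γ + mass₂ H γ)) =
      (t : ℝ) ^ (H - 1 / 2) * (t : ℝ) ^ γ * (M * (mass₁ H γ + mass₂ H γ)) by ring,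
      ← Real.rpow_add ht0, show H - 1 / 2 + γ = γ - (1 / 2 - H) by ring]
    refine (mul_le_mul_of_nonneg_right key (by positivity)).trans ?_
    rw [NNReal.coe_zero, sub_zero] at hdp
    have : M * (mass₁ H γ + mass₂ H γ) ≤
        M * (2 * mass₁ H b + mass₁ H γ + 2 * mass₂ H γ) :=
      mul_le_mul_of_nonneg_left (by linarith) hM
    calc _ ≤ (T : ℝ) ^ (b - (1 / 2 - H)) * (t : ℝ) ^ (γ - b) *
          (M * (2 * mass₁ H b + mass₁ H γ + 2 * mass₂ H γ)) :=
          mul_le_mul_of_nonneg_left this (by positivity)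
      _ = _ := by ring
  have hr : (0 : ℝ) < r := NNReal.coe_pos.2 (pos_iff_ne_zero.2 hr0)
  rw [Lam_eq_profile H f ht0, Lam_eq_profile H f hr]
  -- The variation of the singular prefactor is paired with the profile at the smaller time `r`,
  -- whose decay of order `r ^ γ` compensates for the blow-up of `r ^ (H - 1/2)`.
  have split : (t : ℝ) ^ (H - 1 / 2) * profile H f t - (r : ℝ) ^ (H - 1 / 2) * profile H f r =
      (t : ℝ) ^ (H - 1 / 2) * (profile H f t - profile H f r) +
        ((t : ℝ) ^ (H - 1 / 2) - (r : ℝ) ^ (H - 1 / 2)) * profile H f r := by ring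
  rw [split]
  refine (abs_add_le _ _).trans ?_
  rw [abs_mul, abs_mul, abs_of_nonneg (Real.rpow_nonneg t.coe_nonneg _)]
  have p1 := mul_le_mul_of_nonneg_left (hf.abs_profile_sub_le hc hf0 hM hH0 hH hb hbγ hrt ht)
    (Real.rpow_nonneg t.coe_nonneg (H - 1 / 2))
  have p2 := mul_le_mul_of_nonneg_left (hf.abs_profile_le hf0 hM hH0 hH hγ (hrt.trans ht))
    (abs_nonneg ((t : ℝ) ^ (H - 1 / 2) - (r : ℝ) ^ (H - 1 / 2)))
  have q1 : (t : ℝ) ^ (H - 1 / 2) * (t : ℝ) ^ b ≤ (T : ℝ) ^ (b - (1 / 2 - H)) := by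
    rw [← Real.rpow_add ht0, show H - 1 / 2 + b = b - (1 / 2 - H) by ring]
    exact Real.rpow_le_rpow t.coe_nonneg ht' (by linarith)
  have q2 : (t : ℝ) ^ (H - 1 / 2) * ((t : ℝ) - r) ^ γ ≤
      (T : ℝ) ^ (b - (1 / 2 - H)) * ((t : ℝ) - r) ^ (γ - b) := by
    refine le_trans ?_ key
    rw [show γ - (1 / 2 - H) = (H - 1 / 2) + γ by ring, Real.rpow_add hd]
    refine mul_le_mul_of_nonneg_right ?_ (Real.rpow_nonneg hd.le _)
    exact Real.rpow_le_rpow_of_nonpos hd (by linarith [r.coe_nonneg]) (by linarith)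
  have q3 := (rpow_mul_rpow_neg_sub_le (a := 1 / 2 - H) (γ := γ) (by linarith) (by linarith)
    hγ hγ1 hr hrt').trans key
  rw [show -(1 / 2 - H) = H - 1 / 2 by ring] at q3
  have s1 := mul_le_mul_of_nonneg_right q1
    (show 0 ≤ 2 * M * ((t : ℝ) - r) ^ (γ - b) * mass₁ H b by positivity)
  have s2 := mul_le_mul_of_nonneg_right q2 (show 0 ≤ M * mass₂ H γ by positivity)
  have s3 := mul_le_mul_of_nonneg_right q3 (show 0 ≤ M * (mass₁ H γ + mass₂ H γ) by positivity)
  linarith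

end Holder

/-! ### The embedded times of a continuous path -/

section Times

variable {f : ℝ≥0 → ℝ} {ε : ℝ}

lemma knightTime_succ (f : ℝ≥0 → ℝ) (ε : ℝ) (n : ℕ) :
    knightTime f ε (n + 1) = ⨅ (t : ℝ≥0) (_ : knightTime f ε n < t ∧
      |f t - f (knightTime f ε n).toNNReal| = ε), (t : ℝ≥0∞) := rfl

lemma knightTime_mono (f : ℝ≥0 → ℝ) (ε : ℝ) : Monotone (knightTime f ε) :=
  monotone_nat_of_le_succ fun n => by
    rw [knightTime_succ]
    exact le_iInf₂ fun t ht => ht.1.le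

lemma knightTime_succ_spec (hf : Continuous f) (hε : 0 < ε) {n : ℕ} {a r : ℝ≥0}
    (ha : knightTime f ε n = a) (hr : knightTime f ε (n + 1) = r) :
    a < r ∧ |f r - f a| = ε := by
  set S : Set ℝ≥0 := {t | a < t ∧ |f t - f a| = ε} with hS
  have h1 : knightTime f ε (n + 1) = ⨅ t ∈ S, (t : ℝ≥0∞) := by
    rw [knightTime_succ, ha]
    simp [hS]
  have hne : S.Nonempty := by
    by_contra h
    rw [Set.not_nonempty_iff_eq_empty] at h
    rw [h1, h] at hr
    simp at hr
  rw [← ENNReal.coe_sInf hne, hr, ENNReal.coe_inj] at h1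
  -- The hitting set itself need not be closed, because of `a < t`; relaxing to `a ≤ t` shows that
  -- the infimum is attained, and `ε > 0` then excludes `r = a`.
  have hcl : IsClosed {t : ℝ≥0 | a ≤ t ∧ |f t - f a| = ε} :=
    (isClosed_le continuous_const continuous_id).inter
      (isClosed_eq (by fun_prop) continuous_const)
  have hmem : r ∈ {t : ℝ≥0 | a ≤ t ∧ |f t - f a| = ε} := by
    rw [h1]
    exact hcl.closure_subset_iff.2 (fun t ht => ⟨ht.1.le, ht.2⟩)
      (csInf_mem_closure hne (OrderBot.bddBelow S))
  refine ⟨lt_of_le_of_ne hmem.1 ?_, hmem.2⟩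
  rintro rfl
  have := hmem.2
  simp only [sub_self, abs_zero] at this
  exact hε.ne this

lemma knightTime_lt_succ (hf : Continuous f) (hε : 0 < ε) {n : ℕ}
    (h : knightTime f ε n ≠ ∞) : knightTime f ε n < knightTime f ε (n + 1) := by
  rcases eq_or_ne (knightTime f ε (n + 1)) ∞ with h' | h'
  · rw [h']; exact h.lt_top
  · have := (knightTime_succ_spec hf hε (ENNReal.coe_toNNReal h).symm
      (ENNReal.coe_toNNReal h').symm).1
    rw [← ENNReal.coe_toNNReal h, ← ENNReal.coe_toNNReal h']
    exact_mod_cast this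

lemma abs_sub_lt_of_lt_knightTime (hf : Continuous f) (hε : 0 < ε) {n : ℕ} {a t : ℝ≥0}
    (ha : knightTime f ε n = a) (hat : a ≤ t) (ht : t < knightTime f ε (n + 1)) :
    |f t - f a| < ε := by
  by_contra! h
  have hc : ContinuousOn (fun u => |f u - f a|) (Set.Icc a t) := by fun_prop
  obtain ⟨u, hu, hu'⟩ := intermediate_value_Icc hat hc (show ε ∈ Set.Icc _ _ by
    simp only [sub_self, abs_zero]; exact ⟨hε.le, h⟩)
  have hau : a < u := by
    refine lt_of_le_of_ne hu.1 ?_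
    rintro rfl
    simp only [sub_self, abs_zero] at hu'
    exact hε.ne hu'
  have : knightTime f ε (n + 1) ≤ u := by
    rw [knightTime_succ, ha]
    exact iInf₂_le u ⟨by exact_mod_cast hau, by simpa using hu'⟩
  exact absurd (ht.trans_le this) (by simpa using hu.2)

/-- Only finitely many of the times lie below a given level. -/
lemma exists_knightTime_le_lt (hf : Continuous f) (hε : 0 < ε) (s : ℝ≥0) :
    ∃ n, ∃ a : ℝ≥0, knightTime f ε n = a ∧ a ≤ s ∧ s < knightTime f ε (n + 1) := by
  by_contra! hcon
  have hle : ∀ n, knightTime f ε n ≤ s := by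
    intro n
    induction n with
    | zero => simp [knightTime]
    | succ n ih =>
      have hfin : knightTime f ε n ≠ ∞ := ne_top_of_le_ne_top ENNReal.coe_ne_top ih
      refine hcon n _ (ENNReal.coe_toNNReal hfin).symm ?_
      rwa [← ENNReal.coe_le_coe, ENNReal.coe_toNNReal hfin]
  have hfin : ∀ n, knightTime f ε n ≠ ∞ := fun n => ne_top_of_le_ne_top ENNReal.coe_ne_top (hle n)
  set u : ℕ → ℝ≥0 := fun n => (knightTime f ε n).toNNReal with hu
  have hmono : Monotone u := fun m n h => ENNReal.toNNReal_mono (hfin n) (knightTime_mono f ε h)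
  have hbdd : BddAbove (Set.range u) := ⟨s, by
    rintro _ ⟨n, rfl⟩
    exact ENNReal.toNNReal_mono ENNReal.coe_ne_top (hle n)⟩
  -- Bounded monotone times converge, so by continuity the increments along them tend to `0`,
  -- although each has size exactly `ε`.
  have hlim := (hf.tendsto _).comp (tendsto_atTop_ciSup hmono hbdd)
  have h0 := ((hlim.comp (tendsto_add_atTop_nat 1)).sub hlim).abs
  rw [sub_self, abs_zero] at h0
  have hconst : ∀ n, |f (u (n + 1)) - f (u n)| = ε := fun n =>
    (knightTime_succ_spec hf hε (ENNReal.coe_toNNReal (hfin n)).symm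
      (ENNReal.coe_toNNReal (hfin (n + 1))).symm).2
  have : Tendsto (fun _ : ℕ => ε) atTop (𝓝 0) := h0.congr hconst
  exact hε.ne' (tendsto_nhds_unique tendsto_const_nhds this)

variable {n : ℕ} {a s : ℝ≥0}

lemma knightTime_le_iff (ha : knightTime f ε n = a) (has : a ≤ s)
    (hs : s < knightTime f ε (n + 1)) (m : ℕ) : knightTime f ε m ≤ s ↔ m ≤ n := by
  constructor
  · intro h
    by_contra! hlt
    exact absurd (hs.trans_le ((knightTime_mono f ε hlt).trans h)) (lt_irrefl _)
  · intro h
    refine (knightTime_mono f ε h).trans ?_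
    rw [ha]
    exact_mod_cast has

lemma lastTime_eq (ha : knightTime f ε n = a) (has : a ≤ s)
    (hs : s < knightTime f ε (n + 1)) : lastTime f ε s = a := by
  refine IsGreatest.csSup_eq ⟨⟨has, n, ha⟩, ?_⟩
  rintro r ⟨hr, m, hm⟩
  have h1 : m ≤ n := (knightTime_le_iff ha has hs m).1 (by rw [hm]; exact_mod_cast hr)
  have h2 := knightTime_mono f ε h1
  rw [hm, ha] at h2
  exact_mod_cast h2

lemma knightWalk_eq (ha : knightTime f ε n = a) (has : a ≤ s)
    (hs : s < knightTime f ε (n + 1)) : knightWalk f ε s = f a - f 0 := by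
  rw [knightWalk, tsum_eq_sum (s := Finset.range n)]
  · have : ∀ m ∈ Finset.range n, (if knightTime f ε (m + 1) ≤ s then
        f (knightTime f ε (m + 1)).toNNReal - f (knightTime f ε m).toNNReal else 0) =
        f (knightTime f ε (m + 1)).toNNReal - f (knightTime f ε m).toNNReal := fun m hm =>
      if_pos ((knightTime_le_iff ha has hs _).2 (Finset.mem_range.1 hm))
    rw [Finset.sum_congr rfl this,
      Finset.sum_range_sub (fun m => f (knightTime f ε m).toNNReal), ha]
    simp [knightTime]
  · intro m hm
    refine if_neg fun h => hm (Finset.mem_range.2 ?_)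
    exact (knightTime_le_iff ha has hs _).1 h

lemma nextTime_eq (T : ℝ≥0) (hf : Continuous f) (hε : 0 < ε) (ha : knightTime f ε n = a)
    (has : a ≤ s) (hs : s < knightTime f ε (n + 1)) :
    nextTime f ε T s = (knightTime f ε (n + 1) ⊓ T).toNNReal := by
  have hfin : knightTime f ε n ≠ ∞ := by rw [ha]; exact ENNReal.coe_ne_top
  rw [nextTime, lastTime_eq ha has hs, ← ha]
  congr 2
  refine le_antisymm (iInf₂_le (n + 1) (knightTime_lt_succ hf hε hfin)) (le_iInf₂ fun m hm => ?_)
  refine knightTime_mono f ε ?_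
  by_contra! h
  exact absurd (hm.trans_le (knightTime_mono f ε (Nat.lt_succ_iff.1 h))) (lt_irrefl _)

lemma lastTime_le (f : ℝ≥0 → ℝ) (ε : ℝ) (t : ℝ≥0) : lastTime f ε t ≤ t :=
  csSup_le ⟨0, zero_le, 0, by simp [knightTime]⟩ fun _ hr => hr.1

lemma knightWalk_eq_lastTime (hf : Continuous f) (hf0 : f 0 = 0) (hε : 0 < ε) (s : ℝ≥0) :
    knightWalk f ε s = f (lastTime f ε s) := by
  obtain ⟨n, a, ha, has, hs⟩ := exists_knightTime_le_lt hf hε s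
  rw [knightWalk_eq ha has hs, lastTime_eq ha has hs, hf0, sub_zero]

lemma knightWalk_lastTime (hf : Continuous f) (hf0 : f 0 = 0) (hε : 0 < ε) (s : ℝ≥0) :
    knightWalk f ε (lastTime f ε s) = f (lastTime f ε s) := by
  obtain ⟨n, a, ha, has, hs⟩ := exists_knightTime_le_lt hf hε s
  rw [lastTime_eq ha has hs, knightWalk_eq ha le_rfl (lt_of_le_of_lt (by exact_mod_cast has) hs),
    hf0, sub_zero]

lemma abs_sub_lastTime_le (hf : Continuous f) (hε : 0 < ε) {u : ℝ≥0}
    (hu : lastTime f ε s ≤ u) (hus : u ≤ s) : |f u - f (lastTime f ε s)| ≤ ε := by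
  obtain ⟨n, a, ha, has, hs⟩ := exists_knightTime_le_lt hf hε s
  rw [lastTime_eq ha has hs] at hu ⊢
  exact (abs_sub_lt_of_lt_knightTime hf hε ha hu
    (lt_of_le_of_lt (by exact_mod_cast hus) hs)).le

/-- Before the last embedded time of `t` the truncation at `T` is inactive, so the next time is a
genuine `T_{n+1}`, where walk and path agree. The bound `2 ε` is one `ε` from `T_n` to `T_{n+1}` and
one from `T_n` to `s`. -/
lemma nextTime_spec {T t : ℝ≥0} (hf : Continuous f) (hf0 : f 0 = 0) (hε : 0 < ε) (htT : t ≤ T)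
    (hst : s < lastTime f ε t) :
    s ≤ nextTime f ε T s ∧ nextTime f ε T s ≤ lastTime f ε t ∧
      knightWalk f ε (nextTime f ε T s) = f (nextTime f ε T s) ∧
      |f (nextTime f ε T s) - f s| ≤ 2 * ε := by
  obtain ⟨n, a, ha, has, hs⟩ := exists_knightTime_le_lt hf hε s
  obtain ⟨N, c, hc, hct, ht⟩ := exists_knightTime_le_lt hf hε t
  rw [lastTime_eq hc hct ht] at hst ⊢
  have hnN : n + 1 ≤ N := by
    by_contra! h
    have := knightTime_mono f ε (Nat.lt_succ_iff.1 h)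
    rw [hc, ha] at this
    exact absurd (hst.trans_le (by exact_mod_cast this : c ≤ a)) (not_lt.2 has)
  have hle : knightTime f ε (n + 1) ≤ c := hc ▸ knightTime_mono f ε hnN
  have hfin : knightTime f ε (n + 1) ≠ ∞ := ne_top_of_le_ne_top ENNReal.coe_ne_top hle
  obtain ⟨r, hr⟩ : ∃ r : ℝ≥0, knightTime f ε (n + 1) = r :=
    ⟨_, (ENNReal.coe_toNNReal hfin).symm⟩
  rw [hr] at hle hs
  have hrc : r ≤ c := by exact_mod_cast hle
  have hsr : s < r := by exact_mod_cast hs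
  have hrT : r ≤ T := hrc.trans (hct.trans htT)
  have hnext : nextTime f ε T s = r := by
    rw [nextTime_eq T hf hε ha has (hr ▸ hs), hr, inf_of_le_left (by exact_mod_cast hrT),
      ENNReal.toNNReal_coe]
  rw [hnext]
  refine ⟨hsr.le, hrc, ?_, ?_⟩
  · have h := knightTime_lt_succ hf hε hfin
    rw [knightWalk_eq hr le_rfl (by rwa [hr] at h), hf0, sub_zero]
  · have h1 := (knightTime_succ_spec hf hε ha hr).2
    have h2 := abs_sub_lt_of_lt_knightTime hf hε ha has (hr ▸ hs)
    rw [abs_sub_comm] at h2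
    have := abs_sub_le (f r) (f a) (f s)
    linarith

lemma lastTime_mono (f : ℝ≥0 → ℝ) (ε : ℝ) : Monotone (lastTime f ε) := fun s t hst =>
  csSup_le_csSup ⟨t, fun _ hr => hr.1⟩ ⟨0, zero_le, 0, by simp [knightTime]⟩
    fun _ hr => ⟨hr.1.trans hst, hr.2⟩

/-- Monotonicity supplies the measurability in `s` of the integrand containing the next embedded
time. -/
lemma nextTime_mono (f : ℝ≥0 → ℝ) (ε : ℝ) (T : ℝ≥0) : Monotone (nextTime f ε T) := by
  intro s t hst
  refine ENNReal.toNNReal_mono (ne_top_of_le_ne_top ENNReal.coe_ne_top inf_le_right)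
    (inf_le_inf_right _ (le_iInf₂ fun n hn => ?_))
  have h := lt_of_le_of_lt (ENNReal.coe_le_coe.2 (lastTime_mono f ε hst)) hn
  exact iInf_le_of_le n (iInf_le _ h)

lemma measurable_knightWalk (hf : Continuous f) (hf0 : f 0 = 0) (hε : 0 < ε) :
    Measurable (knightWalk f ε) := by
  rw [funext (knightWalk_eq_lastTime hf hf0 hε)]
  exact hf.measurable.comp (lastTime_mono f ε).measurable

end Times

/-! ### Distance between the approximation and `Λ_H` at the last time -/

section Approx

variable {f : ℝ≥0 → ℝ} {H γ M η ε : ℝ} {T t : ℝ≥0}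

/-- The geometric mean of the two bounds with weights `η` and `1 - η`; `M ≥ 1` keeps the result
linear in `M`. -/
lemma interpolate_le {x d : ℝ} (hM : 1 ≤ M) (hη0 : 0 ≤ η) (hη1 : η ≤ 1) (hε : 0 < ε) (hd : 0 ≤ d)
    (hx : 0 ≤ x) (h1 : x ≤ 2 * ε) (h2 : x ≤ M * d ^ γ) :
    x ≤ 2 * M * ε ^ η * d ^ (γ * (1 - η)) := by
  have h := le_rpow_mul_rpow hx h1 h2 (θ := 1 - η) (by linarith) (by linarith)
  rw [sub_sub_cancel, Real.mul_rpow two_pos.le hε.le, Real.mul_rpow (by linarith)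
    (Real.rpow_nonneg hd _), ← Real.rpow_mul hd] at h
  refine h.trans ?_
  have e1 : (2 : ℝ) ^ η ≤ 2 := by
    simpa using Real.rpow_le_rpow_of_exponent_le one_le_two hη1
  have e2 : M ^ (1 - η) ≤ M := by
    simpa using Real.rpow_le_rpow_of_exponent_le hM (show 1 - η ≤ 1 by linarith)
  have e3 := mul_le_mul e1 e2 (Real.rpow_nonneg (by linarith) _) two_pos.le
  have := mul_le_mul_of_nonneg_right e3
    (mul_nonneg (Real.rpow_nonneg hε.le η) (Real.rpow_nonneg hd (γ * (1 - η))))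
  linarith

lemma HolderPath.abs_approx_sub_Lam_le (hf : HolderPath T γ M f) (hc : Continuous f)
    (hf0 : f 0 = 0) (hM : 1 ≤ M) (hH0 : 0 < H) (hH : H < 1 / 2) (hγ : 1 / 2 - H < γ)
    (hη0 : 0 ≤ η) (hη1 : η ≤ 1) (hb : 1 / 2 - H < γ * (1 - η)) (hε : 0 < ε) (ht : t ≤ T) :
    |approx H T f ε t - Lam H f (lastTime f ε t)| ≤
      2 * (T : ℝ) ^ (H - 1 / 2 + γ * (1 - η)) *
        (mass₁ H (γ * (1 - η)) + mass₂ H (γ * (1 - η))) * M * ε ^ η := by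
  set b := γ * (1 - η) with hbdef
  set τ := lastTime f ε t with hτ
  have hm1 := mass₁_nonneg H b
  have hm2 := mass₂_nonneg H b
  have hεη := Real.rpow_nonneg hε.le η
  have hTb := Real.rpow_nonneg T.coe_nonneg (H - 1 / 2 + b)
  have hτT : τ ≤ T := (lastTime_le f ε t).trans ht
  rcases eq_or_ne τ 0 with h0 | h0
  · rw [approx, ← hτ, h0]
    simp only [NNReal.coe_zero, intervalIntegral.integral_same, sub_self, Lam_zero, abs_zero]
    positivity
  have hτ0 : (0 : ℝ) < τ := NNReal.coe_pos.2 (pos_iff_ne_zero.2 h0)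
  have hτT' : (τ : ℝ) ≤ T := hτT
  set e₁ : ℝ → ℝ := fun s =>
    (knightWalk f ε τ - knightWalk f ε (nextTime f ε T s.toNNReal)) - (f τ - f s.toNNReal) with he₁
  set e₂ : ℝ → ℝ := fun s => knightWalk f ε s.toNNReal - f s.toNNReal with he₂
  have hfm : Measurable fun s : ℝ => f s.toNNReal := hc.measurable.comp measurable_real_toNNReal
  have hw := measurable_knightWalk hc hf0 hε
  have me₁ : Measurable e₁ := (measurable_const.sub (hw.comp ((nextTime_mono f ε T).measurable.comp
    measurable_real_toNNReal))).sub (measurable_const.sub hfm)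
  have me₂ : Measurable e₂ := (hw.comp measurable_real_toNNReal).sub hfm
  have hc0 : 0 ≤ 2 * M * ε ^ η := by positivity
  have he₁le : ∀ s ∈ Set.Ioo 0 (τ : ℝ), |e₁ s| ≤ 2 * M * ε ^ η * (τ - s) ^ b := by
    intro s hs
    have hsτ : s.toNNReal < τ := (Real.toNNReal_lt_iff_lt_coe hs.1.le).2 hs.2
    obtain ⟨n1, n2, n3, n4⟩ := nextTime_spec hc hf0 hε ht hsτ
    have hval : |e₁ s| = |f (nextTime f ε T s.toNNReal) - f s.toNNReal| := by
      rw [he₁]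
      simp only
      rw [n3, knightWalk_lastTime hc hf0 hε, ← abs_neg]
      congr 1
      ring
    have n1' : s ≤ nextTime f ε T s.toNNReal := Real.toNNReal_le_iff_le_coe.1 n1
    have n2' : (nextTime f ε T s.toNNReal : ℝ) ≤ τ := n2
    rw [hval]
    refine interpolate_le hM hη0 hη1 hε (by linarith [hs.2]) (abs_nonneg _) n4 ?_
    refine (hf _ _ n1 (n2.trans hτT)).trans (mul_le_mul_of_nonneg_left ?_ (by linarith))
    rw [Real.coe_toNNReal _ hs.1.le]
    exact Real.rpow_le_rpow (by linarith) (by linarith) (by linarith)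
  have he₂le : ∀ s ∈ Set.Ioo 0 (τ : ℝ), |e₂ s| ≤ 2 * M * ε ^ η * s ^ b := by
    intro s hs
    have hsτ : s.toNNReal < τ := (Real.toNNReal_lt_iff_lt_coe hs.1.le).2 hs.2
    have n1 := lastTime_le f ε s.toNNReal
    rw [he₂]
    simp only
    rw [knightWalk_eq_lastTime hc hf0 hε, abs_sub_comm]
    refine interpolate_le hM hη0 hη1 hε hs.1.le (abs_nonneg _)
      ((abs_sub_lastTime_le hc hε n1 le_rfl).trans (by linarith)) ?_
    refine (hf _ _ n1 (hsτ.le.trans hτT)).trans (mul_le_mul_of_nonneg_left ?_ (by linarith))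
    rw [Real.coe_toNNReal _ hs.1.le]
    have n1' : (lastTime f ε s.toNNReal : ℝ) ≤ s.toNNReal := n1
    rw [Real.coe_toNNReal _ hs.1.le] at n1'
    exact Real.rpow_le_rpow (by linarith) (by linarith [(lastTime f ε s.toNNReal).coe_nonneg])
      (by linarith)
  obtain ⟨i1, l1⟩ := bound_dK₁ hH hb hτ0 hc0 me₁ he₁le
  obtain ⟨i2, l2⟩ := bound_dK₂ hH0 hH hb hτ0 hc0 me₂ he₂le
  have j1 : IntervalIntegrable (fun s => dK₁ H τ s * (f τ - f s.toNNReal)) volume 0 τ :=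
    (bound_dK₁ hH hγ hτ0 (c := M) (by linarith) (measurable_const.sub hfm) fun s hs => by
      have := hf.real hs.1.le hs.2.le hτT'
      rwa [Real.toNNReal_coe] at this).1
  have j2 : IntervalIntegrable (fun s => dK₂ H τ s * f s.toNNReal) volume 0 τ :=
    (bound_dK₂ hH0 hH hγ hτ0 (c := M) (by linarith) hfm fun s hs => by
      have := hf.real le_rfl hs.1.le (hs.2.le.trans hτT')
      rwa [Real.toNNReal_zero, hf0, sub_zero, sub_zero] at this).1
  -- Each integrand of the approximation is split into its error and the corresponding integrand of
  -- `Λ_H`; all four pieces are integrable, so the integrals may be separated.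
  have hdiff : approx H T f ε t - Lam H f τ =
      (∫ s in (0 : ℝ)..τ, dK₁ H τ s * e₁ s) - ∫ s in (0 : ℝ)..τ, dK₂ H τ s * e₂ s := by
    have a1 : (∫ s in (0 : ℝ)..τ, dK₁ H τ s *
        (knightWalk f ε τ - knightWalk f ε (nextTime f ε T s.toNNReal))) =
        (∫ s in (0 : ℝ)..τ, dK₁ H τ s * e₁ s) +
          ∫ s in (0 : ℝ)..τ, dK₁ H τ s * (f τ - f s.toNNReal) := by
      rw [← intervalIntegral.integral_add i1 j1]
      congr 1
      ext s
      rw [he₁]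
      ring
    have a2 : (∫ s in (0 : ℝ)..τ, dK₂ H τ s * knightWalk f ε s.toNNReal) =
        (∫ s in (0 : ℝ)..τ, dK₂ H τ s * e₂ s) + ∫ s in (0 : ℝ)..τ, dK₂ H τ s * f s.toNNReal := by
      rw [← intervalIntegral.integral_add i2 j2]
      congr 1
      ext s
      rw [he₂]
      ring
    have a3 : (∫ s in (0 : ℝ)..τ, (f τ - f s.toNNReal) * dK₁ H τ s) =
        ∫ s in (0 : ℝ)..τ, dK₁ H τ s * (f τ - f s.toNNReal) := by
      simp only [mul_comm]
    rw [approx, Lam, ← hτ, a1, a2, a3]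
    ring
  rw [hdiff]
  refine (abs_sub _ _).trans ((add_le_add l1 l2).trans ?_)
  have hpow : (τ : ℝ) ^ (H - 1 / 2 + b) ≤ (T : ℝ) ^ (H - 1 / 2 + b) :=
    Real.rpow_le_rpow τ.coe_nonneg hτT' (by linarith)
  have := mul_le_mul_of_nonneg_right hpow
    (show 0 ≤ 2 * M * ε ^ η * (mass₁ H b + mass₂ H b) by positivity)
  linarith

end Approx

/-! ### Dyadic chaining -/

/-- The dyadic point `k T / 2 ^ n` of `[0, T]`. -/
noncomputable def dyad (T : ℝ≥0) (n k : ℕ) : ℝ≥0 := k * T / 2 ^ n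

lemma dyad_two_mul (T : ℝ≥0) (n k : ℕ) : dyad T (n + 1) (2 * k) = dyad T n k := by
  rw [dyad, dyad, pow_succ]
  push_cast
  rw [mul_assoc, mul_comm (2 ^ n : ℝ≥0) 2, mul_div_mul_left _ _ two_ne_zero]

/-- The index of the last dyadic point of level `n` before `t`. -/
noncomputable def dyadIndex (T t : ℝ≥0) (n : ℕ) : ℕ := ⌊(t / T : ℝ) * 2 ^ n⌋₊

lemma tendsto_dyad_dyadIndex {T : ℝ≥0} (hT : 0 < T) (t : ℝ≥0) :
    Tendsto (fun n => dyad T n (dyadIndex T t n)) atTop (𝓝 t) := by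
  have hT' : (T : ℝ) ≠ 0 := (NNReal.coe_pos.2 hT).ne'
  rw [← NNReal.tendsto_coe]
  have h1 : Tendsto (fun n : ℕ => (2 : ℝ) ^ n) atTop atTop :=
    tendsto_pow_atTop_atTop_of_one_lt one_lt_two
  have h2 := ((tendsto_nat_floor_mul_div_atTop (R := ℝ) (a := (t / T : ℝ)) (by positivity)).comp
    h1).mul_const (T : ℝ)
  rw [div_mul_cancel₀ _ hT'] at h2
  refine h2.congr fun n => ?_
  simp only [Function.comp_apply, dyad, dyadIndex]
  push_cast
  ring

lemma dyadIndex_le {T t : ℝ≥0} (hT : 0 < T) (ht : t ≤ T) (n : ℕ) : dyadIndex T t n ≤ 2 ^ n := by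
  have h : (t / T : ℝ) ≤ 1 := (div_le_one (NNReal.coe_pos.2 hT)).2 ht
  refine Nat.floor_le_of_le ?_
  push_cast
  exact mul_le_of_le_one_left (by positivity) h

lemma dyadIndex_succ (T t : ℝ≥0) (n : ℕ) :
    dyadIndex T t (n + 1) = 2 * dyadIndex T t n ∨
      dyadIndex T t (n + 1) = 2 * dyadIndex T t n + 1 := by
  have hx : (0 : ℝ) ≤ (t / T : ℝ) * 2 ^ n := by positivity
  have e : (t / T : ℝ) * 2 ^ (n + 1) = 2 * ((t / T : ℝ) * 2 ^ n) := by ring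
  have h1 : 2 * dyadIndex T t n ≤ dyadIndex T t (n + 1) := by
    refine Nat.le_floor ?_
    rw [e]
    push_cast
    exact mul_le_mul_of_nonneg_left (Nat.floor_le hx) two_pos.le
  have h2 : dyadIndex T t (n + 1) < 2 * dyadIndex T t n + 2 := by
    refine (Nat.floor_lt (by positivity)).2 ?_
    rw [e]
    push_cast
    have := Nat.lt_floor_add_one ((t / T : ℝ) * 2 ^ n)
    rw [dyadIndex]
    linarith
  omega

lemma dyadIndex_of_sub_le {T s t : ℝ≥0} {n : ℕ} (hst : s ≤ t)
    (h : (t / T : ℝ) - s / T ≤ (1 / 2) ^ n) :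
    dyadIndex T t n = dyadIndex T s n ∨ dyadIndex T t n = dyadIndex T s n + 1 := by
  have hst' : (s / T : ℝ) ≤ t / T := div_le_div_of_nonneg_right hst T.coe_nonneg
  have h1 : dyadIndex T s n ≤ dyadIndex T t n :=
    Nat.floor_le_floor (mul_le_mul_of_nonneg_right hst' (by positivity))
  have h2 : dyadIndex T t n < dyadIndex T s n + 2 := by
    refine (Nat.floor_lt (by positivity)).2 ?_
    push_cast
    have := Nat.lt_floor_add_one ((s / T : ℝ) * 2 ^ n)
    have h3 := mul_le_mul_of_nonneg_right h (show (0 : ℝ) ≤ 2 ^ n by positivity)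
    rw [← mul_pow, one_div_mul_cancel two_ne_zero, one_pow] at h3
    rw [dyadIndex]
    linarith
  omega

/-- The constant of the chaining argument. -/
noncomputable def chainConst (T : ℝ≥0) (γ : ℝ) : ℝ :=
  2 ^ γ * (1 + 2 / (1 - (1 / 2) ^ γ)) / (T : ℝ) ^ γ

lemma chainConst_pos {T : ℝ≥0} {γ : ℝ} (hT : 0 < T) (hγ : 0 < γ) : 0 < chainConst T γ := by
  have h1 : ((1 : ℝ) / 2) ^ γ < 1 := Real.rpow_lt_one (by norm_num) (by norm_num) hγ
  have h2 : 0 < 1 - ((1 : ℝ) / 2) ^ γ := by linarith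
  have h3 : (0 : ℝ) < T := hT
  unfold chainConst
  positivity

/-- Chaining: passing from one dyadic approximation of a point to the next moves by at most one step
of the finer grid, so the error at level `n` is a geometric tail. Two points at distance about `T /
2 ^ n` have equal or neighbouring approximations at level `n`. -/
lemma holderPath_of_dyad {T : ℝ≥0} {γ K : ℝ} {f : ℝ≥0 → ℝ} (hT : 0 < T) (hγ : 0 < γ)
    (hf : Continuous f) (hK : 0 ≤ K)
    (h : ∀ n, ∀ k < 2 ^ n, |f (dyad T n (k + 1)) - f (dyad T n k)| ≤ K * (((1 : ℝ) / 2) ^ γ) ^ n) :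
    HolderPath T γ (chainConst T γ * K) f := by
  set ρ : ℝ := ((1 : ℝ) / 2) ^ γ with hρ
  have hρ1 : ρ < 1 := Real.rpow_lt_one (by norm_num) (by norm_num) hγ
  have hρ0 : 0 ≤ ρ := Real.rpow_nonneg (by norm_num) _
  have hT' : (0 : ℝ) < T := hT
  have hstep : ∀ t ≤ T, ∀ n, dist (f (dyad T n (dyadIndex T t n)))
      (f (dyad T (n + 1) (dyadIndex T t (n + 1)))) ≤ K * ρ ^ n := by
    intro t ht n
    rcases dyadIndex_succ T t n with e | e
    · rw [e, dyad_two_mul, dist_self]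
      positivity
    · have hlt : 2 * dyadIndex T t n < 2 ^ (n + 1) := by
        have := dyadIndex_le hT ht (n + 1)
        omega
      have := h (n + 1) _ hlt
      rw [e, dist_comm, Real.dist_eq, ← dyad_two_mul T n]
      refine this.trans (mul_le_mul_of_nonneg_left ?_ hK)
      exact pow_le_pow_of_le_one hρ0 hρ1.le (Nat.le_succ n)
  have hdist : ∀ t ≤ T, ∀ n, |f (dyad T n (dyadIndex T t n)) - f t| ≤ K * ρ ^ n / (1 - ρ) :=
    fun t ht n => dist_le_of_le_geometric_of_tendsto ρ K hρ1 (hstep t ht)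
      ((hf.tendsto t).comp (tendsto_dyad_dyadIndex hT t)) n
  intro s t hst ht
  rcases hst.eq_or_lt with rfl | hlt
  · simp only [sub_self, abs_zero]
    exact mul_nonneg (mul_nonneg (chainConst_pos hT hγ).le hK) (Real.rpow_nonneg le_rfl _)
  have hlt' : (s : ℝ) < t := hlt
  have ht' : (t : ℝ) ≤ T := ht
  have hd0 : 0 < (t / T : ℝ) - s / T := by
    rw [← sub_div]
    exact div_pos (by linarith) hT'
  have hd1 : (t / T : ℝ) - s / T ≤ 1 := by
    rw [← sub_div, div_le_one hT']
    linarith [s.coe_nonneg]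
  -- The level with `2 ^ (-(n + 1)) < (t - s) / T ≤ 2 ^ (-n)`; the lower bound costs the factor `2 ^
  -- γ` in `chainConst`.
  obtain ⟨n, hn1, hn2⟩ := exists_nat_pow_near_of_lt_one hd0 hd1 (show (0 : ℝ) < 1 / 2 by norm_num)
    (by norm_num)
  have hmid : |f (dyad T n (dyadIndex T t n)) - f (dyad T n (dyadIndex T s n))| ≤ K * ρ ^ n := by
    rcases dyadIndex_of_sub_le hst hn2 with e | e
    · rw [e, sub_self, abs_zero]
      positivity
    · rw [e]
      refine h n _ ?_
      have := dyadIndex_le hT ht n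
      omega
  have h1 := hdist t ht n
  have h2 := hdist s (hst.trans ht) n
  have htri : |f t - f s| ≤ K * ρ ^ n * (1 + 2 / (1 - ρ)) := by
    have e : f t - f s = -(f (dyad T n (dyadIndex T t n)) - f t) +
        (f (dyad T n (dyadIndex T t n)) - f (dyad T n (dyadIndex T s n))) +
        (f (dyad T n (dyadIndex T s n)) - f s) := by ring
    rw [e]
    refine (abs_add_three _ _ _).trans ?_
    rw [abs_neg]
    have : K * ρ ^ n * (1 + 2 / (1 - ρ)) =
      K * ρ ^ n / (1 - ρ) + K * ρ ^ n + K * ρ ^ n / (1 - ρ) := by ring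
    linarith
  have hpow : ρ ^ n ≤ 2 ^ γ * (((t : ℝ) - s) ^ γ / (T : ℝ) ^ γ) := by
    have e : ρ ^ n = 2 ^ γ * (((1 : ℝ) / 2) ^ (n + 1)) ^ γ := by
      rw [← Real.mul_rpow two_pos.le (by positivity), pow_succ, hρ, ← Real.rpow_natCast,
        ← Real.rpow_mul (by norm_num), mul_comm γ, Real.rpow_mul (by norm_num), Real.rpow_natCast]
      congr 1
      ring
    rw [e, ← Real.div_rpow (by linarith) hT'.le, sub_div]
    refine mul_le_mul_of_nonneg_left ?_ (by positivity)
    exact Real.rpow_le_rpow (by positivity) hn1.le hγ.le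
  refine htri.trans ?_
  have hc : 0 ≤ K * (1 + 2 / (1 - ρ)) := by
    have : 0 < 1 - ρ := by linarith
    positivity
  have := mul_le_mul_of_nonneg_left hpow hc
  calc K * ρ ^ n * (1 + 2 / (1 - ρ)) = K * (1 + 2 / (1 - ρ)) * ρ ^ n := by ring
    _ ≤ _ := this
    _ = chainConst T γ * K * ((t : ℝ) - s) ^ γ := by rw [chainConst]; ring

/-! ### Moments of the Hölder constant of Brownian motion -/

/-- The absolute moment of order `q` of the standard Gaussian law. -/
noncomputable def gaussMoment (q : ℝ) : ℝ≥0∞ :=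
  ∫⁻ x, ENNReal.ofReal (|x| ^ q) ∂(gaussianReal 0 1)

lemma gaussMoment_ne_top {q : ℝ} (hq : 0 < q) : gaussMoment q ≠ ∞ := by
  have h := (memLp_id_gaussianReal (μ := 0) (v := 1) q.toNNReal).integrable_norm_rpow
    (by simpa using hq) (by simp)
  have h2 := h.lintegral_lt_top
  simp only [id, Real.norm_eq_abs, ENNReal.coe_toReal, Real.coe_toNNReal _ hq.le] at h2
  exact h2.ne

section Brownian

variable {Ω : Type*} [MeasurableSpace Ω] {P : Measure Ω} {B : ℝ≥0 → Ω → ℝ}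

lemma lintegral_increment_rpow (hB : IsPreBrownianReal B P) (s t : ℝ≥0) {c q : ℝ} (hc : 0 ≤ c) :
    ∫⁻ ω, ENNReal.ofReal ((c * |B t ω - B s ω|) ^ q) ∂P =
      ENNReal.ofReal ((c * √(dist (t : ℝ) s)) ^ q) * gaussMoment q := by
  set v : ℝ≥0 := nndist (t : ℝ) s with hv
  have hlaw := hB.hasLaw_sub t s
  have hm : Measurable fun x : ℝ => ENNReal.ofReal ((c * |x|) ^ q) := by fun_prop
  have h1 : ∫⁻ ω, ENNReal.ofReal ((c * |B t ω - B s ω|) ^ q) ∂P =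
      ∫⁻ x, ENNReal.ofReal ((c * |x|) ^ q) ∂(gaussianReal 0 v) :=
    hlaw.lintegral_comp (f := fun x => ENNReal.ofReal ((c * |x|) ^ q)) hm.aemeasurable
  have h2 : gaussianReal 0 v = (gaussianReal 0 1).map (√(v : ℝ) * ·) := by
    rw [gaussianReal_map_const_mul]
    congr 1
    · simp
    · ext
      simp
  rw [h1, h2, lintegral_map hm (by fun_prop), gaussMoment,
    ← lintegral_const_mul _ (by fun_prop)]
  refine lintegral_congr fun x => ?_
  rw [← ENNReal.ofReal_mul (by positivity), abs_mul, abs_of_nonneg (Real.sqrt_nonneg _),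
    ← mul_assoc, Real.mul_rpow (by positivity) (abs_nonneg _)]
  rfl

/-- The random variable `W` controlling all dyadic increments: `W ^ (1/q)` is a Hölder constant. -/
noncomputable def dyadSum (T : ℝ≥0) (γ q : ℝ) (f : ℝ≥0 → ℝ) : ℝ≥0∞ :=
  1 + ∑' n : ℕ, ∑ k ∈ Finset.range (2 ^ n),
    ENNReal.ofReal (((2 ^ γ) ^ n * |f (dyad T n (k + 1)) - f (dyad T n k)|) ^ q)

/-- The expectation of `dyadSum` along a Brownian motion. -/
noncomputable def dyadMean (T : ℝ≥0) (γ q : ℝ) : ℝ≥0∞ :=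
  1 + ENNReal.ofReal (√(T : ℝ) ^ q) * gaussMoment q *
    ∑' n : ℕ, ENNReal.ofReal (2 ^ (1 - q * (1 / 2 - γ))) ^ n

lemma dyadMean_ne_top (T : ℝ≥0) {γ q : ℝ} (hq : 0 < q) (h : 1 < q * (1 / 2 - γ)) :
    dyadMean T γ q ≠ ∞ := by
  have hr : ENNReal.ofReal (2 ^ (1 - q * (1 / 2 - γ))) < 1 := by
    rw [ENNReal.ofReal_lt_one]
    exact Real.rpow_lt_one_of_one_lt_of_neg one_lt_two (by linarith)
  refine ENNReal.add_ne_top.2 ⟨ENNReal.one_ne_top, ENNReal.mul_ne_top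
    (ENNReal.mul_ne_top ENNReal.ofReal_ne_top (gaussMoment_ne_top hq)) ?_⟩
  rw [ENNReal.tsum_geometric]
  exact ENNReal.inv_ne_top.2 (tsub_pos_of_lt hr).ne'

lemma aemeasurable_dyadTerm (hB : IsPreBrownianReal B P) (T : ℝ≥0) (γ q : ℝ) (n k : ℕ) :
    AEMeasurable (fun ω => ENNReal.ofReal
      (((2 ^ γ) ^ n * |B (dyad T n (k + 1)) ω - B (dyad T n k) ω|) ^ q)) P := by
  have h1 := hB.aemeasurable (dyad T n (k + 1))
  have h2 := hB.aemeasurable (dyad T n k)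
  fun_prop

lemma aemeasurable_dyadSum (hB : IsPreBrownianReal B P) (T : ℝ≥0) (γ q : ℝ) :
    AEMeasurable (fun ω => dyadSum T γ q (fun s => B s ω)) P :=
  aemeasurable_const.add (AEMeasurable.tsum fun n =>
    Finset.aemeasurable_fun_sum _ fun k _ => aemeasurable_dyadTerm hB T γ q n k)

/-- Level `n` has `2 ^ n` increments of standard deviation `√T 2 ^ (-n/2)`, so its contribution is
geometric with ratio `2 ^ (1 - q (1/2 - γ))`. -/
lemma lintegral_dyadSum [IsProbabilityMeasure P] (hB : IsPreBrownianReal B P) (T : ℝ≥0)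
    (γ q : ℝ) : ∫⁻ ω, dyadSum T γ q (fun s => B s ω) ∂P = dyadMean T γ q := by
  unfold dyadSum dyadMean
  rw [lintegral_add_left measurable_const, lintegral_const, measure_univ, mul_one,
    lintegral_tsum fun n => Finset.aemeasurable_fun_sum _
      fun k _ => aemeasurable_dyadTerm hB T γ q n k, ← ENNReal.tsum_mul_left]
  congr 2
  ext n
  rw [lintegral_finsetSum' _ fun k _ => aemeasurable_dyadTerm hB T γ q n k]
  have hterm : ∀ k ∈ Finset.range (2 ^ n), ∫⁻ ω, ENNReal.ofReal
      (((2 ^ γ) ^ n * |B (dyad T n (k + 1)) ω - B (dyad T n k) ω|) ^ q) ∂P =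
      ENNReal.ofReal (√(T : ℝ) ^ q * ((2 : ℝ) ^ (-(q * (1 / 2 - γ)))) ^ n) * gaussMoment q := by
    intro k _
    rw [lintegral_increment_rpow hB _ _ (by positivity)]
    congr 2
    have hd : dist (dyad T n (k + 1) : ℝ) (dyad T n k) = T * (2 ^ n)⁻¹ := by
      rw [Real.dist_eq, dyad, dyad]
      push_cast
      rw [show ((k : ℝ) + 1) * T / 2 ^ n - k * T / 2 ^ n = T * (2 ^ n)⁻¹ by ring]
      exact abs_of_nonneg (by positivity)
    rw [hd, Real.sqrt_mul T.coe_nonneg, mul_left_comm, Real.mul_rpow (by positivity)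
      (by positivity)]
    congr 1
    rw [Real.sqrt_eq_rpow, ← Real.rpow_natCast, ← Real.rpow_natCast, ← Real.rpow_natCast,
      ← Real.rpow_neg two_pos.le, ← Real.rpow_mul two_pos.le, ← Real.rpow_mul two_pos.le,
      ← Real.rpow_mul two_pos.le, ← Real.rpow_add two_pos, ← Real.rpow_mul two_pos.le]
    congr 1
    ring
  rw [Finset.sum_congr rfl hterm, Finset.sum_const, Finset.card_range, nsmul_eq_mul,
    ENNReal.ofReal_mul (by positivity), ← ENNReal.ofReal_pow (by positivity), sub_eq_add_neg 1 (q * _),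
    Real.rpow_add two_pos, Real.rpow_one, mul_pow, ENNReal.ofReal_mul (by positivity)]
  have : ENNReal.ofReal ((2 : ℝ) ^ n) = ((2 ^ n : ℕ) : ℝ≥0∞) := by
    rw [← ENNReal.ofReal_natCast]; norm_num
  rw [this]
  ring

lemma holderPath_of_dyadSum {T : ℝ≥0} {γ q : ℝ} {f : ℝ≥0 → ℝ} (hT : 0 < T) (hγ : 0 < γ)
    (hq : 0 < q) (hf : Continuous f) (hW : dyadSum T γ q f ≠ ∞) :
    HolderPath T γ (chainConst T γ * (dyadSum T γ q f).toReal ^ (1 / q)) f := by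
  refine holderPath_of_dyad hT hγ hf (by positivity) fun n k hk => ?_
  set x := |f (dyad T n (k + 1)) - f (dyad T n k)| with hx
  have hx0 : 0 ≤ x := abs_nonneg _
  have h1 : ENNReal.ofReal (((2 ^ γ) ^ n * x) ^ q) ≤ dyadSum T γ q f := by
    refine le_trans ?_ le_add_self
    refine le_trans ?_ (ENNReal.le_tsum n)
    exact Finset.single_le_sum (f := fun k => ENNReal.ofReal
      (((2 ^ γ) ^ n * |f (dyad T n (k + 1)) - f (dyad T n k)|) ^ q))
      (fun _ _ => zero_le) (Finset.mem_range.2 hk)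
  have h2 := (ENNReal.ofReal_le_iff_le_toReal hW).1 h1
  have h3 := Real.rpow_le_rpow (by positivity) h2 (show 0 ≤ 1 / q by positivity)
  rw [← Real.rpow_mul (by positivity), mul_one_div_cancel hq.ne', Real.rpow_one] at h3
  have hp : (0 : ℝ) < (2 ^ γ) ^ n := by positivity
  rw [Real.div_rpow zero_le_one two_pos.le, Real.one_rpow, div_pow, one_pow, mul_one_div,
    le_div_iff₀ hp]
  linarith

/-! ### Long gaps between the embedded times are unlikely -/

/-- The event that all increments over the `m` subintervals of some interval of the uniform
partition of `[0, T]` into `n` intervals are at most `2 ε`. -/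
def stuckSet (B : ℝ≥0 → Ω → ℝ) (T : ℝ≥0) (ε : ℝ) (n m : ℕ) : Set Ω :=
  ⋃ j ∈ Finset.range n, ⋂ l ∈ Finset.Ico (j * m) (j * m + m),
    (fun ω => B ((l + 1 : ℕ) * (T / (n * m))) ω - B (l * (T / (n * m))) ω) ⁻¹'
      Set.Icc (-(2 * ε)) (2 * ε)

/-- The density is at most `1 / √(2 π v) ≤ 1 / (2 √v)`, and the interval has length `4 ε`. -/
lemma gaussianReal_Icc_le {v : ℝ≥0} (hv : v ≠ 0) (ε : ℝ) :
    gaussianReal 0 v (Set.Icc (-(2 * ε)) (2 * ε)) ≤ ENNReal.ofReal (2 * ε / √v) := by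
  have hv' : (0 : ℝ) < v := NNReal.coe_pos.2 (pos_iff_ne_zero.2 hv)
  have hpdf : ∀ x, gaussianPDF 0 v x ≤ ENNReal.ofReal (2 * √v)⁻¹ := by
    intro x
    refine ENNReal.ofReal_le_ofReal ?_
    rw [gaussianPDFReal]
    have h1 : (√(2 * Real.pi * v))⁻¹ ≤ (2 * √v)⁻¹ := by
      refine inv_anti₀ (by positivity) ?_
      rw [show (2 : ℝ) * √v = √(4 * v) by
        rw [Real.sqrt_mul (by norm_num), show (4 : ℝ) = 2 ^ 2 by norm_num,
          Real.sqrt_sq two_pos.le]]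
      refine Real.sqrt_le_sqrt ?_
      nlinarith [Real.pi_gt_three]
    refine (mul_le_of_le_one_right (by positivity) (Real.exp_le_one_iff.2 ?_)).trans h1
    exact div_nonpos_of_nonpos_of_nonneg (neg_nonpos.2 (sq_nonneg _)) (by positivity)
  rw [gaussianReal_apply 0 hv]
  calc ∫⁻ x in Set.Icc (-(2 * ε)) (2 * ε), gaussianPDF 0 v x
      ≤ ∫⁻ _ in Set.Icc (-(2 * ε)) (2 * ε), ENNReal.ofReal (2 * √v)⁻¹ := lintegral_mono hpdf
    _ = ENNReal.ofReal (2 * ε / √v) := by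
      rw [setLIntegral_const, Real.volume_Icc, ← ENNReal.ofReal_mul (by positivity)]
      congr 1
      field_simp
      ring

/-- A union bound over the `n` blocks, and independence of the `m` increments inside each block. -/
lemma measure_stuckSet_le (hB : IsPreBrownianReal B P) {T : ℝ≥0} (hT : 0 < T)
    (ε : ℝ) {n m : ℕ} (hn : 0 < n) (hm : 0 < m) :
    P (stuckSet B T ε n m) ≤ n * ENNReal.ofReal (2 * ε / √(T / (n * m))) ^ m := by
  have hn' : (0 : ℝ≥0) < n := by exact_mod_cast hn
  have hm' : (0 : ℝ≥0) < m := by exact_mod_cast hm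
  set h : ℝ≥0 := T / (n * m) with hh
  have hh0 : 0 < h := div_pos hT (mul_pos hn' hm')
  have hmono : Monotone fun l : ℕ => (l : ℝ≥0) * h := fun a b hab =>
    mul_le_mul_left (by exact_mod_cast hab) h
  have hind := hB.hasIndepIncrements.nat hmono
  have hone : ∀ l : ℕ, P ((fun ω => B ((l + 1 : ℕ) * h) ω - B (l * h) ω) ⁻¹'
      Set.Icc (-(2 * ε)) (2 * ε)) ≤ ENNReal.ofReal (2 * ε / √(T / (n * m))) := by
    intro l
    have hv : nndist (((l + 1 : ℕ) * h : ℝ≥0) : ℝ) ((l * h : ℝ≥0) : ℝ) = h := by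
      ext
      rw [coe_nndist, Real.dist_eq]
      push_cast
      rw [show ((l : ℝ) + 1) * h - l * h = h by ring]
      exact abs_of_nonneg h.coe_nonneg
    have hlaw := hB.hasLaw_sub ((l + 1 : ℕ) * h) (l * h)
    have e : P ((fun ω => B ((l + 1 : ℕ) * h) ω - B (l * h) ω) ⁻¹'
        Set.Icc (-(2 * ε)) (2 * ε)) = gaussianReal 0 h (Set.Icc (-(2 * ε)) (2 * ε)) := by
      have := hlaw.measure_eq (p := fun x => x ∈ Set.Icc (-(2 * ε)) (2 * ε)) measurableSet_Icc
      rw [show gaussianReal 0 h = _ from congrArg (gaussianReal 0) hv.symm]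
      exact this
    rw [e]
    refine (gaussianReal_Icc_le hh0.ne' ε).trans (le_of_eq ?_)
    rw [hh]
    push_cast
    rfl
  refine (measure_biUnion_finset_le _ _).trans ?_
  refine (Finset.sum_le_card_nsmul _ _ (ENNReal.ofReal (2 * ε / √(T / (n * m))) ^ m)
    fun j _ => ?_).trans (by rw [Finset.card_range, nsmul_eq_mul])
  have := hind.measure_inter_preimage_eq_mul (Finset.Ico (j * m) (j * m + m))
    (sets := fun _ => Set.Icc (-(2 * ε)) (2 * ε)) (fun _ _ => measurableSet_Icc)
  rw [this]
  refine (Finset.prod_le_pow_card _ _ _ fun l _ => hone l).trans (le_of_eq ?_)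
  simp

lemma nullMeasurableSet_stuckSet (hB : IsPreBrownianReal B P) (T : ℝ≥0) (ε : ℝ) (n m : ℕ) :
    NullMeasurableSet (stuckSet B T ε n m) P := by
  refine Finset.nullMeasurableSet_biUnion _ fun j _ => Finset.nullMeasurableSet_biInter _
    fun l _ => ?_
  exact ((hB.aemeasurable _).sub (hB.aemeasurable _)).nullMeasurableSet_preimage measurableSet_Icc

end Brownian

/-- A gap longer than two blocks contains a complete block. Throughout the gap the path stays within
`ε` of its value at the last embedded time, so all increments over that block are at most `2 ε`. -/
lemma sub_lastTime_le_of_notMem_stuckSet {Ω : Type*} {B : ℝ≥0 → Ω → ℝ}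
    {T t : ℝ≥0} {ε : ℝ} {n m : ℕ} {ω : Ω} (hT : 0 < T)
    (hε : 0 < ε) (hn : 0 < n) (hm : 0 < m) (hc : Continuous fun s => B s ω) (ht : t ≤ T)
    (hω : ω ∉ stuckSet B T ε n m) :
    (t : ℝ) - lastTime (fun s => B s ω) ε t ≤ 2 * T / n := by
  by_contra! hcon
  refine hω ?_
  set τ := lastTime (fun s => B s ω) ε t with hτ
  have hT' : (0 : ℝ) < T := hT
  have hn' : (0 : ℝ) < n := by exact_mod_cast hn
  have hm' : (0 : ℝ) < m := by exact_mod_cast hm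
  have ht' : (t : ℝ) ≤ T := ht
  set j := ⌈(τ : ℝ) * n / T⌉₊ with hj
  have j1 : (τ : ℝ) * n / T ≤ j := Nat.le_ceil _
  have j2 : (j : ℝ) < (τ : ℝ) * n / T + 1 := Nat.ceil_lt_add_one (by positivity)
  have j3 : (τ : ℝ) * n / T + 2 < t * n / T := by
    rw [div_lt_iff₀ hn'] at hcon
    rw [div_add' _ _ _ hT'.ne', div_lt_div_iff_of_pos_right hT']
    linarith
  have j4 : (t : ℝ) * n / T ≤ n := by
    rw [div_le_iff₀ hT']
    nlinarith
  have hjn : j + 1 ≤ n := by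
    have : ((j + 1 : ℕ) : ℝ) ≤ n := by push_cast; linarith
    exact_mod_cast this
  rw [div_le_iff₀ hT'] at j1
  have j5 : ((j : ℝ) + 1) * T ≤ t * n := by
    rw [← le_div_iff₀ hT']; linarith
  have hin : ∀ l : ℕ, j * m ≤ l → l ≤ j * m + m →
      τ ≤ l * (T / (n * m)) ∧ l * (T / (n * m)) ≤ t := by
    intro l h1 h2
    have h1' : (j : ℝ) * m ≤ l := by exact_mod_cast h1
    have h2' : (l : ℝ) ≤ j * m + m := by exact_mod_cast h2
    rw [← NNReal.coe_le_coe, ← NNReal.coe_le_coe]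
    push_cast
    constructor
    · rw [mul_div_assoc', le_div_iff₀ (by positivity)]
      have := mul_le_mul_of_nonneg_right h1' hT'.le
      have := mul_le_mul_of_nonneg_right j1 hm'.le
      linarith
    · rw [mul_div_assoc', div_le_iff₀ (by positivity)]
      have := mul_le_mul_of_nonneg_right h2' hT'.le
      have := mul_le_mul_of_nonneg_right j5 hm'.le
      linarith
  simp only [stuckSet, Set.mem_iUnion, Set.mem_iInter, Set.mem_preimage]
  refine ⟨j, Finset.mem_range.2 hjn, fun l hl => ?_⟩
  rw [Finset.mem_Ico] at hl
  obtain ⟨a1, a2⟩ := hin l hl.1 hl.2.le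
  obtain ⟨b1, b2⟩ := hin (l + 1) (hl.1.trans (Nat.le_succ l)) hl.2
  have c1 := abs_sub_lastTime_le hc hε a1 a2
  have c2 := abs_sub_lastTime_le hc hε b1 b2
  rw [abs_le] at c1 c2
  constructor <;> linarith [c1.1, c1.2, c2.1, c2.2]

/-! ### The moment estimate -/

/-- With about `ε ^ (-κ)` blocks, one small increment has probability of order `ε ^ (1 - κ/2)`, so
the event has order `ε ^ (m (1 - κ/2) - κ)`. For `κ < 2`, a large `m` reaches any power. -/
lemma exists_measure_stuckSet_le {T : ℝ≥0} {κ N : ℝ} {m : ℕ} (hT : 0 < T) (hκ : 0 < κ)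
    (hm : 0 < m) (hN : 0 ≤ N) (hNm : N ≤ m * (1 - κ / 2) - κ) :
    ∃ S : ℝ, 0 < S ∧ ∀ (Ω : Type*) [MeasurableSpace Ω] (P : Measure Ω) [IsProbabilityMeasure P]
      (B : ℝ≥0 → Ω → ℝ), IsPreBrownianReal B P → ∀ ε : ℝ, 0 < ε →
        P (stuckSet B T ε ⌈ε ^ (-κ)⌉₊ m) ≤ ENNReal.ofReal (S * ε ^ N) := by
  have hT' : (0 : ℝ) < T := hT
  have hm' : (0 : ℝ) < m := by exact_mod_cast hm
  refine ⟨max 1 (2 * (2 * √(2 * m / T)) ^ m), lt_max_of_lt_left one_pos, ?_⟩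
  intro Ω _ P _ B hB ε hε
  have hεN : 0 ≤ ε ^ N := Real.rpow_nonneg hε.le _
  rcases le_total 1 ε with h1 | h1
  · refine prob_le_one.trans ?_
    rw [ENNReal.one_le_ofReal]
    exact one_le_mul_of_one_le_of_one_le (le_max_left _ _) (Real.one_le_rpow h1 hN)
  set n := ⌈ε ^ (-κ)⌉₊ with hn
  have hx1 : 1 ≤ ε ^ (-κ) := Real.one_le_rpow_of_pos_of_le_one_of_nonpos hε h1 (by linarith)
  have hn0 : 0 < n := Nat.ceil_pos.2 (by linarith)
  have hn' : (0 : ℝ) < n := by exact_mod_cast hn0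
  have hn2 : (n : ℝ) ≤ 2 * ε ^ (-κ) := by
    have := Nat.ceil_lt_add_one (show 0 ≤ ε ^ (-κ) by linarith)
    linarith
  refine (measure_stuckSet_le hB hT ε hn0 hm).trans ?_
  rw [← ENNReal.ofReal_natCast, ← ENNReal.ofReal_pow (by positivity),
    ← ENNReal.ofReal_mul (by positivity)]
  refine ENNReal.ofReal_le_ofReal ?_
  have e1 : 2 * ε / √((T : ℝ) / (n * m)) ≤ 2 * √(2 * m / T) * ε ^ (1 - κ / 2) := by
    have e2 : √(2 * m / T) * ε ^ (-(κ / 2)) = √(2 * m / T * ε ^ (-κ)) := by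
      rw [Real.sqrt_mul (by positivity), Real.sqrt_eq_rpow (ε ^ (-κ)), ← Real.rpow_mul hε.le]
      congr 2
      ring
    have e3 : (√((T : ℝ) / (n * m)))⁻¹ ≤ √(2 * m / T) * ε ^ (-(κ / 2)) := by
      rw [e2, ← Real.sqrt_inv, inv_div]
      refine Real.sqrt_le_sqrt ?_
      rw [div_mul_eq_mul_div]
      refine div_le_div_of_nonneg_right ?_ hT'.le
      nlinarith
    rw [sub_eq_add_neg, Real.rpow_add hε, Real.rpow_one, div_eq_mul_inv]
    calc 2 * ε * (√((T : ℝ) / (n * m)))⁻¹ ≤ 2 * ε * (√(2 * m / T) * ε ^ (-(κ / 2))) :=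
          mul_le_mul_of_nonneg_left e3 (by positivity)
      _ = _ := by ring
  calc (n : ℝ) * (2 * ε / √((T : ℝ) / (n * m))) ^ m
      ≤ 2 * ε ^ (-κ) * (2 * √(2 * m / T) * ε ^ (1 - κ / 2)) ^ m :=
        mul_le_mul hn2 (pow_le_pow_left₀ (by positivity) e1 m) (by positivity) (by positivity)
    _ = 2 * (2 * √(2 * m / T)) ^ m * ε ^ (m * (1 - κ / 2) - κ) := by
        rw [mul_pow, ← Real.rpow_natCast (ε ^ (1 - κ / 2)), ← Real.rpow_mul hε.le,
          show (m : ℝ) * (1 - κ / 2) - κ = -κ + (1 - κ / 2) * m by ring, Real.rpow_add hε]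
        ring
    _ ≤ max 1 (2 * (2 * √(2 * m / T)) ^ m) * ε ^ N :=
        mul_le_mul (le_max_right _ _) (Real.rpow_le_rpow_of_exponent_ge hε h1 hNm)
          (by positivity) (by positivity)

/-- Pathwise bound of the distance between `approx` and `Λ_H` in terms of a Hölder constant and of
the distance to the last embedded time. -/
lemma HolderPath.abs_approx_sub_Lam_le_of_gap {f : ℝ≥0 → ℝ} {H γ M η ε d : ℝ} {T t : ℝ≥0}
    (hf : HolderPath T γ M f) (hc : Continuous f) (hf0 : f 0 = 0) (hM : 1 ≤ M) (hH0 : 0 < H)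
    (hH : H < 1 / 2) (hγ1 : γ ≤ 1) (hη0 : 0 ≤ η) (hηH : η ≤ H) (hb : 1 / 2 - H < γ * (1 - H))
    (hε : 0 < ε) (ht : t ≤ T) (hd : (t : ℝ) - lastTime f ε t ≤ d) :
    |approx H T f ε t - Lam H f t| ≤
      (2 * (T : ℝ) ^ (H - 1 / 2 + γ * (1 - η)) *
        (mass₁ H (γ * (1 - η)) + mass₂ H (γ * (1 - η))) +
      (T : ℝ) ^ (γ * (1 - H) - (1 / 2 - H)) *
        (2 * mass₁ H (γ * (1 - H)) + mass₁ H γ + 2 * mass₂ H γ)) * M * (ε ^ η + d ^ (γ * H)) := by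
  have hγ0 : 0 < γ := by
    by_contra! h
    nlinarith
  have hb1 : γ * (1 - H) < γ := by nlinarith
  -- Because `η ≤ H`, the single condition `hb` makes the weights of both estimates admissible.
  have hb2 : γ * (1 - H) ≤ γ * (1 - η) := mul_le_mul_of_nonneg_left (by linarith) hγ0.le
  have h1 := hf.abs_approx_sub_Lam_le hc hf0 hM hH0 hH (hb.trans hb1) hη0 (by linarith)
    (hb.trans_le hb2) hε ht
  have h2 := hf.abs_Lam_sub_le hc hf0 (by linarith) hH0 hH hb hb1 hγ1 (lastTime_le f ε t) ht
  have hlt : (lastTime f ε t : ℝ) ≤ t := lastTime_le f ε t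
  have h3 : ((t : ℝ) - lastTime f ε t) ^ (γ - γ * (1 - H)) ≤ d ^ (γ * H) := by
    rw [show γ - γ * (1 - H) = γ * H by ring]
    exact Real.rpow_le_rpow (by linarith) hd (by positivity)
  have m1 := mass₁_nonneg H (γ * (1 - η))
  have m2 := mass₂_nonneg H (γ * (1 - η))
  have m3 := mass₁_nonneg H (γ * (1 - H))
  have m4 := mass₁_nonneg H γ
  have m5 := mass₂_nonneg H γ
  set C₁ := 2 * (T : ℝ) ^ (H - 1 / 2 + γ * (1 - η)) *
    (mass₁ H (γ * (1 - η)) + mass₂ H (γ * (1 - η))) with hC₁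
  set C₂ := (T : ℝ) ^ (γ * (1 - H) - (1 / 2 - H)) *
    (2 * mass₁ H (γ * (1 - H)) + mass₁ H γ + 2 * mass₂ H γ) with hC₂
  have hC₁0 : 0 ≤ C₁ := by positivity
  have hC₂0 : 0 ≤ C₂ := by positivity
  have h4 := h2.trans (mul_le_mul_of_nonneg_left h3 (show 0 ≤ C₂ * M by positivity))
  have hε0 := Real.rpow_nonneg hε.le η
  have hd0 : 0 ≤ d ^ (γ * H) := Real.rpow_nonneg (by linarith) _
  have htri := abs_sub_le (approx H T f ε t) (Lam H f (lastTime f ε t)) (Lam H f t)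
  rw [abs_sub_comm (Lam H f (lastTime f ε t))] at htri
  have x1 : 0 ≤ C₁ * M * d ^ (γ * H) := by positivity
  have x2 : 0 ≤ C₂ * M * ε ^ η := by positivity
  linarith

/-- Since `W ≥ 1`, the power `W ^ (r p)` is at most `W ^ (1/2)`, and Cauchy–Schwarz separates `W ^
(1/2)` from the indicator of `A`. Only the upper bound is integrated, so `X`, later a supremum over
uncountably many times, need not be measurable. -/
lemma lintegral_rpow_le {Ω : Type*} [MeasurableSpace Ω] {P : Measure Ω} {X W : Ω → ℝ≥0∞}
    {A : Set Ω} {D E e : ℝ≥0∞} {p r : ℝ} (hW : AEMeasurable W P) (hW1 : ∀ ω, 1 ≤ W ω)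
    (hA : NullMeasurableSet A P) (hp : 1 ≤ p) (hpr : r * p ≤ 1 / 2)
    (hE : ∫⁻ ω, W ω ∂P ≤ E) (hE1 : 1 ≤ E)
    (hX : ∀ᵐ ω ∂P, X ω ≤ D * W ω ^ r * (e + A.indicator 1 ω)) :
    ∫⁻ ω, X ω ^ p ∂P ≤ D ^ p * 2 ^ (p - 1) * E * (e ^ p + P A ^ (1 / 2 : ℝ)) := by
  have hp0 : 0 ≤ p := by linarith
  have hWh : AEMeasurable (fun ω => W ω ^ (1 / 2 : ℝ)) P := hW.pow_const _
  have hind : AEMeasurable (A.indicator (1 : Ω → ℝ≥0∞)) P :=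
    (aemeasurable_indicator_const_iff (1 : ℝ≥0∞)).2 hA
  have hpt : ∀ᵐ ω ∂P, X ω ^ p ≤ D ^ p * 2 ^ (p - 1) *
      (W ω ^ (1 / 2 : ℝ) * e ^ p + W ω ^ (1 / 2 : ℝ) * A.indicator 1 ω) := by
    filter_upwards [hX] with ω hω
    have hi : (A.indicator (1 : Ω → ℝ≥0∞) ω) ^ p = A.indicator 1 ω := by
      by_cases h : ω ∈ A
      · simp [h]
      · simp [h, show 0 < p by linarith]
    calc X ω ^ p ≤ (D * W ω ^ r * (e + A.indicator 1 ω)) ^ p := ENNReal.rpow_le_rpow hω hp0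
      _ = D ^ p * W ω ^ (r * p) * (e + A.indicator 1 ω) ^ p := by
        rw [ENNReal.mul_rpow_of_nonneg _ _ hp0, ENNReal.mul_rpow_of_nonneg _ _ hp0,
          ← ENNReal.rpow_mul]
      _ ≤ D ^ p * W ω ^ (1 / 2 : ℝ) * (2 ^ (p - 1) * (e ^ p + A.indicator 1 ω)) := by
        refine mul_le_mul' (mul_le_mul' le_rfl
          (ENNReal.rpow_le_rpow_of_exponent_le (hW1 ω) hpr)) ?_
        have h := ENNReal.rpow_add_le_mul_rpow_add_rpow e (A.indicator 1 ω) hp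
        rwa [hi] at h
      _ = _ := by ring
  have hI1 : ∫⁻ ω, W ω ^ (1 / 2 : ℝ) ∂P ≤ E := by
    refine le_trans (lintegral_mono fun ω => ?_) hE
    simpa using ENNReal.rpow_le_rpow_of_exponent_le (hW1 ω) (show (1 / 2 : ℝ) ≤ 1 by norm_num)
  have hI2 : ∫⁻ ω, W ω ^ (1 / 2 : ℝ) * A.indicator 1 ω ∂P ≤ E * P A ^ (1 / 2 : ℝ) := by
    have h := ENNReal.lintegral_mul_le_Lp_mul_Lq P Real.HolderConjugate.two_two hWh hind
    refine h.trans (mul_le_mul' ?_ (le_of_eq ?_))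
    · have : ∀ ω, (W ω ^ (1 / 2 : ℝ)) ^ (2 : ℝ) = W ω := fun ω => by
        rw [← ENNReal.rpow_mul]; norm_num
      simp only [this]
      refine (ENNReal.rpow_le_rpow hE (by norm_num)).trans ?_
      simpa using ENNReal.rpow_le_rpow_of_exponent_le hE1 (show (1 / 2 : ℝ) ≤ 1 by norm_num)
    · congr 1
      have : ∀ ω, (A.indicator (1 : Ω → ℝ≥0∞) ω) ^ (2 : ℝ) = A.indicator 1 ω := fun ω => by
        by_cases h : ω ∈ A <;> simp [h]
      simp only [this]
      exact lintegral_indicator_one₀ hA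
  refine (lintegral_mono_ae hpt).trans ?_
  have hadd : AEMeasurable (fun ω => W ω ^ (1 / 2 : ℝ) * e ^ p +
      W ω ^ (1 / 2 : ℝ) * A.indicator 1 ω) P := (hWh.mul_const _).add (hWh.mul hind)
  rw [lintegral_const_mul'' _ hadd, lintegral_add_left' (hWh.mul_const _), lintegral_mul_const'' _ hWh, mul_assoc (D ^ p * _)]
  refine mul_le_mul' le_rfl ?_
  rw [mul_add]
  exact add_le_add (mul_le_mul' hI1 le_rfl) hI2

lemma supNorm_le {T : ℝ≥0} {f : ℝ≥0 → ℝ} {x : ℝ} (h : ∀ t ≤ T, |f t| ≤ x) :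
    supNorm T f ≤ ENNReal.ofReal x :=
  iSup₂_le fun t ht => by
    rw [Real.enorm_eq_ofReal_abs]
    exact ENNReal.ofReal_le_ofReal (h t ht)

lemma one_le_dyadSum (T : ℝ≥0) (γ q : ℝ) (f : ℝ≥0 → ℝ) : 1 ≤ dyadSum T γ q f := le_self_add

/-- The moment estimate at a rate `η < H`. -/
theorem exists_lintegral_supNorm_le {H p η : ℝ} {T : ℝ≥0} (hH0 : 0 < H) (hH : H < 1 / 2)
    (hp : 1 ≤ p) (hT : 0 < T) (hη0 : 0 < η) (hηH : η < H) :
    ∃ C : ℝ, 0 < C ∧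
      ∀ (Ω : Type*) [MeasurableSpace Ω] (P : Measure Ω) [IsProbabilityMeasure P]
        (B BH : ℝ≥0 → Ω → ℝ), IsBrownianReal B P →
        (∀ᵐ ω ∂P, ∀ t ≤ T, BH t ω = Lam H (fun s => B s ω) t) →
        ∀ ε : ℝ, 0 < ε →
        ∫⁻ ω, supNorm T (fun t => approx H T (fun s => B s ω) ε t - BH t ω) ^ p ∂P
          ≤ ENNReal.ofReal (C * ε ^ (p * η)) := by
  have hT' : (0 : ℝ) < T := hT
  -- The first lower bound gives `γ (1 - H) > 1/2 - H`, needed by the kernels; the second gives `κ <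
  -- 2`, needed for the gaps. Brownian paths allow any `γ < 1/2`.
  obtain ⟨γ, hγl, hγ2⟩ : ∃ γ, max ((1 / 2 - H) / (1 - H)) (η / (2 * H)) < γ ∧ γ < 1 / 2 := by
    refine exists_between (max_lt ?_ ?_)
    · rw [div_lt_iff₀ (by linarith)]; linarith
    · rw [div_lt_iff₀ (by linarith)]; linarith
  obtain ⟨hγa, hγb⟩ := max_lt_iff.1 hγl
  have hb : 1 / 2 - H < γ * (1 - H) := (div_lt_iff₀ (by linarith)).1 hγa
  have hγ0 : 0 < γ := lt_trans (by positivity) hγb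
  have hγη : η < γ * (2 * H) := (div_lt_iff₀ (by linarith)).1 hγb
  set κ := η / (γ * H) with hκ
  have hκ0 : 0 < κ := by positivity
  have hκ2 : κ < 2 := by
    rw [hκ, div_lt_iff₀ (by positivity)]; linarith
  have hκη : κ * (γ * H) = η := div_mul_cancel₀ _ (by positivity)
  -- The first entry leaves at most the power `1/2` of `dyadSum` after raising to `p`; the second
  -- makes its mean finite.
  set q := max (2 * p) (2 / (1 / 2 - γ)) with hq
  have hqp : 2 * p ≤ q := le_max_left _ _
  have hq0 : 0 < q := by linarith
  have hqγ : 1 < q * (1 / 2 - γ) := by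
    have : 2 ≤ q * (1 / 2 - γ) := (div_le_iff₀ (by linarith)).1 (le_max_right _ _)
    linarith
  -- The target power is `2 p η`, twice the final one, because Cauchy–Schwarz takes the square root
  -- of the probability.
  obtain ⟨m, hm⟩ := exists_nat_ge (max 1 ((2 * (p * η) + κ) / (1 - κ / 2)))
  obtain ⟨hm1, hm2⟩ := max_le_iff.1 hm
  have hm0 : 0 < m := by exact_mod_cast lt_of_lt_of_le one_pos hm1
  rw [div_le_iff₀ (by linarith)] at hm2
  have hpη : 0 < p * η := by positivity
  obtain ⟨S, hS0, hS⟩ := exists_measure_stuckSet_le (N := 2 * (p * η)) hT hκ0 hm0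
    (by positivity) (by linarith)
  set C₀ := 2 * (T : ℝ) ^ (H - 1 / 2 + γ * (1 - η)) *
        (mass₁ H (γ * (1 - η)) + mass₂ H (γ * (1 - η))) +
      (T : ℝ) ^ (γ * (1 - H) - (1 / 2 - H)) *
        (2 * mass₁ H (γ * (1 - H)) + mass₁ H γ + 2 * mass₂ H γ) with hC₀
  have hC₀0 : 0 ≤ C₀ := by
    have m1 := mass₁_nonneg H (γ * (1 - η))
    have m2 := mass₂_nonneg H (γ * (1 - η))
    have m3 := mass₁_nonneg H (γ * (1 - H))
    have m4 := mass₁_nonneg H γ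
    have m5 := mass₂_nonneg H γ
    positivity
  have hc := chainConst_pos hT hγ0
  set D := (1 + C₀) * (1 + chainConst T γ) * (1 + (2 * T : ℝ) ^ (γ * H)) with hD
  have hD0 : 0 < D := by positivity
  have hE := dyadMean_ne_top T hq0 hqγ
  have hE1 : 1 ≤ dyadMean T γ q := le_self_add
  have hE0 : 0 < (dyadMean T γ q).toReal :=
    ENNReal.toReal_pos (lt_of_lt_of_le one_pos hE1).ne' hE
  refine ⟨D ^ p * 2 ^ (p - 1) * (dyadMean T γ q).toReal * (1 + √S), by positivity, ?_⟩
  intro Ω _ P _ B BH hB hBH ε hε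
  have hε0 := Real.rpow_pos_of_pos hε η
  have hpre := hB.toIsPreBrownianReal
  set A := stuckSet B T ε ⌈ε ^ (-κ)⌉₊ m with hA
  have hn0 : 0 < ⌈ε ^ (-κ)⌉₊ := Nat.ceil_pos.2 (Real.rpow_pos_of_pos hε _)
  have hWm := aemeasurable_dyadSum hpre T γ q
  have hfin : ∀ᵐ ω ∂P, dyadSum T γ q (fun s => B s ω) < ∞ :=
    ae_lt_top' hWm (by rw [lintegral_dyadSum hpre]; exact hE)
  have key := lintegral_rpow_le
    (X := fun ω => supNorm T (fun t => approx H T (fun s => B s ω) ε t - BH t ω))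
    (W := fun ω => dyadSum T γ q (fun s => B s ω)) (A := A) (D := ENNReal.ofReal D)
    (E := dyadMean T γ q) (e := ENNReal.ofReal (ε ^ η)) (p := p) (r := 1 / q) hWm
    (fun ω => one_le_dyadSum T γ q _) (nullMeasurableSet_stuckSet hpre T ε _ m) hp
    (by rw [one_div_mul_eq_div, div_le_iff₀ hq0]; linarith)
    (lintegral_dyadSum hpre T γ q).le hE1 (by
      filter_upwards [hB.cont, hpre.eval_zero_ae_eq_zero, hBH, hfin] with ω hcont h0 hbh hW
      set W := dyadSum T γ q (fun s => B s ω) with hWdef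
      have hW1 : 1 ≤ W.toReal := by
        have := ENNReal.toReal_mono hW.ne (one_le_dyadSum T γ q (fun s => B s ω))
        simpa using this
      have hWq : 1 ≤ W.toReal ^ (1 / q) := Real.one_le_rpow hW1 (by positivity)
      set M := (1 + chainConst T γ) * W.toReal ^ (1 / q) with hMdef
      have hM : 1 ≤ M := one_le_mul_of_one_le_of_one_le (by linarith) hWq
      have hhol : HolderPath T γ M (fun s => B s ω) := fun s t hst ht =>
        (holderPath_of_dyadSum hT hγ0 hq0 hcont hW.ne s t hst ht).trans
          (mul_le_mul_of_nonneg_right (mul_le_mul_of_nonneg_right (by linarith) (by linarith))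
            (Real.rpow_nonneg (sub_nonneg.2 hst) _))
      have hbound : ∀ t ≤ T, ∀ d : ℝ, (t : ℝ) - lastTime (fun s => B s ω) ε t ≤ d →
          |approx H T (fun s => B s ω) ε t - BH t ω| ≤ C₀ * M * (ε ^ η + d ^ (γ * H)) := by
        intro t ht d hd
        rw [hbh t ht]
        exact hhol.abs_approx_sub_Lam_le_of_gap hcont h0 hM hH0 hH (by linarith) hη0.le hηH.le
          hb hε ht hd
      have hcoef : ∀ y : ℝ, 0 ≤ y → C₀ * M * (y * (1 + (2 * T : ℝ) ^ (γ * H))) ≤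
          D * W.toReal ^ (1 / q) * y := by
        intro y hy
        have : C₀ * (M * (y * (1 + (2 * T : ℝ) ^ (γ * H)))) ≤
            (1 + C₀) * (M * (y * (1 + (2 * T : ℝ) ^ (γ * H)))) :=
          mul_le_mul_of_nonneg_right (by linarith) (by positivity)
        calc _ = C₀ * (M * (y * (1 + (2 * T : ℝ) ^ (γ * H)))) := by ring
          _ ≤ _ := this
          _ = _ := by rw [hD, hMdef]; ring
      have hWr : W ^ (1 / q) = ENNReal.ofReal (W.toReal ^ (1 / q)) := by
        rw [← ENNReal.ofReal_rpow_of_nonneg (by linarith) (by positivity),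
          ENNReal.ofReal_toReal hW.ne]
      by_cases hωA : ω ∈ A
      · rw [Set.indicator_of_mem hωA, Pi.one_apply, hWr, ← ENNReal.ofReal_one,
          ← ENNReal.ofReal_add hε0.le zero_le_one, ← ENNReal.ofReal_mul hD0.le,
          ← ENNReal.ofReal_mul (by positivity)]
        refine supNorm_le fun t ht => ?_
        have ht' : (t : ℝ) ≤ T := ht
        -- On the bad event the trivial gap bound is relaxed to `2 T`, so that the same factor `(2
        -- T) ^ (γ H)` serves in both cases.
        refine (hbound t ht (2 * T) (by
          linarith [(lastTime (fun s => B s ω) ε t).coe_nonneg])).trans ?_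
        refine le_trans (mul_le_mul_of_nonneg_left ?_ (by positivity))
          (hcoef (ε ^ η + 1) (by positivity))
        have : 0 ≤ ε ^ η * (2 * T : ℝ) ^ (γ * H) := by positivity
        linarith
      · rw [Set.indicator_of_notMem hωA, add_zero, hWr, ← ENNReal.ofReal_mul hD0.le,
          ← ENNReal.ofReal_mul (by positivity)]
        refine supNorm_le fun t ht => ?_
        have hgap := sub_lastTime_le_of_notMem_stuckSet hT hε hn0 hm0 hcont ht hωA
        have hgap2 : 2 * (T : ℝ) / (⌈ε ^ (-κ)⌉₊ : ℕ) ≤ 2 * T * ε ^ κ := by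
          rw [div_le_iff₀ (by exact_mod_cast hn0), mul_assoc]
          refine le_mul_of_one_le_right (by positivity) ?_
          have := mul_le_mul_of_nonneg_left (Nat.le_ceil (ε ^ (-κ)))
            (Real.rpow_nonneg hε.le κ)
          rwa [← Real.rpow_add hε, add_neg_cancel, Real.rpow_zero] at this
        refine (hbound t ht _ (hgap.trans hgap2)).trans ?_
        refine le_trans (mul_le_mul_of_nonneg_left (le_of_eq ?_) (by positivity))
          (hcoef (ε ^ η) hε0.le)
        rw [Real.mul_rpow (by positivity) (Real.rpow_nonneg hε.le _), ← Real.rpow_mul hε.le, hκη]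
        ring)
  refine key.trans ?_
  have hPA : P A ^ (1 / 2 : ℝ) ≤ ENNReal.ofReal (√S * ε ^ (p * η)) := by
    refine (ENNReal.rpow_le_rpow (hS Ω P B hpre ε hε) (by norm_num)).trans (le_of_eq ?_)
    rw [ENNReal.ofReal_rpow_of_nonneg (by positivity) (by norm_num),
      Real.mul_rpow hS0.le (by positivity), ← Real.rpow_mul hε.le, ← Real.sqrt_eq_rpow]
    congr 3
    ring
  have he : ENNReal.ofReal (ε ^ η) ^ p = ENNReal.ofReal (ε ^ (p * η)) := by
    rw [ENNReal.ofReal_rpow_of_pos hε0, ← Real.rpow_mul hε.le, mul_comm]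
  rw [he]
  refine (mul_le_mul' le_rfl (add_le_add le_rfl hPA)).trans (le_of_eq ?_)
  rw [← ENNReal.ofReal_add (by positivity) (by positivity), ENNReal.ofReal_rpow_of_pos hD0,
    ← ENNReal.ofReal_ofNat 2, ENNReal.ofReal_rpow_of_pos two_pos]
  nth_rewrite 1 [← ENNReal.ofReal_toReal hE]
  rw [← ENNReal.ofReal_mul (by positivity), ← ENNReal.ofReal_mul (by positivity),
    ← ENNReal.ofReal_mul (by positivity)]
  congr 1
  ring

end KnightFBM

/-- `B` is a standard Brownian motion and `BH` is the fractional Brownian motion that it realizes,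
`BH = Λ_H B` on `[0, T]` almost surely. The constant depends only on `p, δ, H, T, lam`. -/
theorem theorem3p1 (H p δ lam : ℝ) (T : ℝ≥0) (hH0 : 0 < H) (hH : H < 1 / 2) (hp : 1 ≤ p)
    (hT : 0 < T) (hδ0 : max 0 (1 - p * H / 2) < δ) (hδ1 : δ < 1)
    (hlam0 : (1 - H) / 2 < lam) (hlam1 : lam < 1 / 2 + (2 * δ - 2) / (2 * p)) :
    ∃ C : ℝ, 0 < C ∧
      ∀ (Ω : Type*) [MeasurableSpace Ω] (P : Measure Ω) [IsProbabilityMeasure P]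
        (B BH : ℝ≥0 → Ω → ℝ), IsBrownianReal B P →
        (∀ᵐ ω ∂P, ∀ t ≤ T, BH t ω = KnightFBM.Lam H (fun s => B s ω) t) →
        ∀ ε : ℕ → ℝ, (∀ k, 0 < ε k) → Antitone ε → Tendsto ε atTop (𝓝 0) →
        ∀ k, ∫⁻ ω, KnightFBM.supNorm T
              (fun t => KnightFBM.approx H T (fun s => B s ω) (ε k) t - BH t ω) ^ p ∂P
            ≤ ENNReal.ofReal (C * ε k ^ (p * (1 - 2 * lam) + 2 * (δ - 1))) := by
  have hp0 : 0 < p := by linarith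
  -- The rate per power of the norm: the upper bound on `lam` gives `η > 0`, and the lower bound
  -- together with `δ < 1` gives `η < H`.
  set η := (p * (1 - 2 * lam) + 2 * (δ - 1)) / p with hη
  have hη0 : 0 < η := by
    refine div_pos ?_ hp0
    have h1 : (2 * δ - 2) / (2 * p) * (2 * p) = 2 * δ - 2 := div_mul_cancel₀ _ (by positivity)
    have h2 := mul_lt_mul_of_pos_right hlam1 (show 0 < 2 * p by positivity)
    rw [add_mul, h1] at h2
    linarith
  have hηH : η < H := by
    rw [hη, div_lt_iff₀ hp0]
    nlinarith
  obtain ⟨C, hC0, hC⟩ := KnightFBM.exists_lintegral_supNorm_le hH0 hH hp hT hη0 hηH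
  refine ⟨C, hC0, fun Ω _ P _ B BH hB hBH ε hε _ _ k => ?_⟩
  have := hC Ω P B BH hB hBH (ε k) (hε k)
  rwa [hη, mul_div_cancel₀ _ hp0.ne'] at this
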